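/- \textbf{Theorem.} Consider random access machines whose registers $R_0,R_1,\dots$ hold natural numbers and whose instructions are: loading a constant, copying a register, indirect load and store, addition, truncated subtraction, multiplication, jump, jump if a register is zero, and an instruction that outputs, for two numbers $i,j$ held in registers, the word $R_iR_{i+1}\cdots R_j$. An arithmetic instruction takes time linear in the bit lengths of its two inputs; every other instruction takes constant time. The space used by the machine at a given step is the total number of bits of the integers in its registers. There are such a machine and a constant $C$ with the following property. Let $D$ be a monotone DNF over $n$ variables $x_1,\dots,x_n$, that is, a finite set of terms none of which contains a negated literal; let $m$ be its number of terms, and let $\mathsf{sat}(D)\subseteq\{0,1\}^n$ be its set of models. Given $n$, $m$ and the terms of $D$ (in any order, without repetition, each as a row of $n$ symbols, one per variable) in consecutive registers that start at a number fixed by the machine, all other registers being $0$, the machine outputs every model $\alpha$ of $D$ exactly once, as the word $\alpha(x_1)\cdots\alpha(x_n)$, outputs nothing else, and halts. Moreover: \begin{itemize} \item (preprocessing) the first output, or the halt if $D$ has no model, occurs at time at most $C(nm^2+1)$; \item (delay) the time between two consecutive outputs, and between the last output and the halt, is at most $C(n^2+1)$; \item (space) at every step the space used is at most $C(n+1)(|\mathsf{sat}(D)|+1)$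 bits; that is, it is linear in the number of models, each counted with its $n$ bits. \end{itemize} -/

import Mathlib

noncomputable section

namespace EnumDNF

/-! ### Formulas in disjunctive normal form -/

/-- A literal on the variables `x_0, …, x_{n-1}`: a variable with its sign
(`true` for the variable itself, `false` for its negation). -/
abbrev Literal (n : ℕ) := Fin n × Bool

/-- A term: a finite set of literals, any two of which have different variables. -/
abbrev Term (n : ℕ) :=
  {T : Finset (Literal n) // ∀ l₁ ∈ T, ∀ l₂ ∈ T, l₁.1 = l₂.1 → l₁ = l₂}

/-- A DNF formula: a finite set of terms. -/
abbrev DNF (n : ℕ) := Finset (Term n)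

/-- Assignments of truth values to the `n` variables. -/
abbrev Assignment (n : ℕ) := Fin n → Bool

/-- An assignment satisfies a literal when it gives its variable the sign of the literal. -/
def SatisfiesLiteral {n : ℕ} (α : Assignment n) (l : Literal n) : Prop := α l.1 = l.2

def SatisfiesTerm {n : ℕ} (α : Assignment n) (T : Term n) : Prop :=
  ∀ l ∈ T.1, SatisfiesLiteral α l

/-- The set of models of a DNF: the assignments that satisfy one of its terms. -/
def sat {n : ℕ} (D : DNF n) : Set (Assignment n) :=
  {α | ∃ T ∈ D, SatisfiesTerm α T}

/-- A DNF is monotone when it contains no negated literal. -/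
def IsMonotone {n : ℕ} (D : DNF n) : Prop :=
  ∀ T ∈ D, ∀ l ∈ T.1, l.2 = true

/-! ### Random access machines -/

/-- Instructions. Registers `R_0, R_1, …` hold natural numbers; `r`, `s`, `t` are
register numbers and `l` is the index of an instruction. -/
inductive Instr where
  /-- `R_r := c` -/
  | const (r c : ℕ)
  /-- `R_r := R_s` -/
  | copy (r s : ℕ)
  /-- `R_r := R_{R_s}` -/
  | load (r s : ℕ)
  /-- `R_{R_r} := R_s` -/
  | store (r s : ℕ)
  /-- `R_r := R_s + R_t` -/
  | add (r s t : ℕ)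
  /-- `R_r := max (R_s - R_t) 0` -/
  | sub (r s t : ℕ)
  /-- `R_r := R_s * R_t` -/
  | mul (r s t : ℕ)
  /-- continue at instruction `l` -/
  | jump (l : ℕ)
  /-- continue at instruction `l` if `R_r = 0` -/
  | jumpZero (r l : ℕ)
  /-- output the values of `R_i, R_{i+1}, …, R_j`, where `i = R_r` and `j = R_s` -/
  | output (r s : ℕ)

/-- A program: a finite list of instructions, together with the number `base` of
the register where its input starts. The registers `R_0, …, R_{base-1}` are initially `0`. -/
structure Program where
  code : List Instr
  base : ℕ

/-- A configuration: the index of the next instruction, the contents of the registers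
(only finitely many are non-zero), the time elapsed, and
the words output so far, in order, each with the time at which it was output. -/
structure Config where
  pc : ℕ
  regs : ℕ →₀ ℕ
  time : ℕ
  outputs : List (ℕ × List ℕ)

/-- The time taken by an instruction: linear in the bit lengths of the two inputs for an
arithmetic instruction, constant for every other one. -/
def Instr.cost (R : ℕ →₀ ℕ) : Instr → ℕ
  | .add _ s t => 1 + Nat.size (R s) + Nat.size (R t)
  | .sub _ s t => 1 + Nat.size (R s) + Nat.size (R t)
  | .mul _ s t => 1 + Nat.size (R s) + Nat.size (R t)
  | _ => 1

/-- The registers after an instruction. -/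
def Instr.newRegs (R : ℕ →₀ ℕ) : Instr → (ℕ →₀ ℕ)
  | .const r c => R.update r c
  | .copy r s => R.update r (R s)
  | .load r s => R.update r (R (R s))
  | .store r s => R.update (R r) (R s)
  | .add r s t => R.update r (R s + R t)
  | .sub r s t => R.update r (R s - R t)
  | .mul r s t => R.update r (R s * R t)
  | .jump _ => R
  | .jumpZero _ _ => R
  | .output _ _ => R

/-- The index of the instruction to be executed next. -/
def Instr.newPc (pc : ℕ) (R : ℕ →₀ ℕ) : Instr → ℕ
  | .jump l => l
  | .jumpZero r l => if R r = 0 then l else pc + 1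
  | _ => pc + 1

/-- The output log after an instruction that ends at time `τ`. -/
def Instr.newOutputs (τ : ℕ) (R : ℕ →₀ ℕ) (out : List (ℕ × List ℕ)) :
    Instr → List (ℕ × List ℕ)
  | .output r s => out ++ [(τ, (List.Ico (R r) (R s + 1)).map R)]
  | _ => out

/-- One step of the machine. It stops when there is no instruction with the index `pc`. -/
def Program.step (P : Program) (c : Config) : Config :=
  match P.code[c.pc]? with
  | none => c
  | some I =>
    { pc := I.newPc c.pc c.regs
      regs := I.newRegs c.regs
      time := c.time + I.cost c.regs
      outputs := I.newOutputs (c.time + I.cost c.regs) c.regs c.outputs }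

/-- The initial configuration on the input `w`: the entries of `w` are in the registers
`R_base, R_{base+1}, …`, and every other register holds `0`. -/
def Program.init (P : Program) (w : List ℕ) : Config where
  pc := 0
  regs := (List.replicate P.base 0 ++ w).toFinsupp
  time := 0
  outputs := []

/-- The configuration after `k` steps on the input `w`. -/
def Program.run (P : Program) (w : List ℕ) (k : ℕ) : Config :=
  P.step^[k] (P.init w)

def Program.Halted (P : Program) (c : Config) : Prop :=
  P.code.length ≤ c.pc

/-- The space in use: the total number of bits of the integers in the registers. -/
def Config.space (c : Config) : ℕ :=
  c.regs.sum fun _ v => Nat.size v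

/-- The times of the outputs up to configuration `c`, followed by the time of `c`. -/
def Config.eventTimes (c : Config) : List ℕ :=
  c.outputs.map Prod.fst ++ [c.time]

/-- On the input `w`, the program `P` halts after having output every word of `A` exactly once
and no other word;
the first output (or the halt, if there is no output) comes at a time at most `prep`;
at most `delay` time elapses between two consecutive outputs, and between the last
output and the halt; and the space in use never exceeds `space`. -/
def Program.Enumerates (P : Program) (w : List ℕ) (A : Set (List ℕ))
    (prep delay space : ℕ) : Prop :=
  (∃ k : ℕ, P.Halted (P.run w k) ∧
    ((P.run w k).outputs.map Prod.snd).Nodup ∧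
    (∀ y : List ℕ, y ∈ (P.run w k).outputs.map Prod.snd ↔ y ∈ A) ∧
    (∀ τ ∈ (P.run w k).eventTimes.head?, τ ≤ prep) ∧
    (P.run w k).eventTimes.IsChain (fun τ τ' => τ' ≤ τ + delay)) ∧
  ∀ k : ℕ, (P.run w k).space ≤ space

/-! ### Formulas and models as words -/

/-- The symbol for the occurrence of the variable `x` in a term: `1` if `x` is in the term,
`2` if its negation is, and `0` if neither is. -/
def symbol {n : ℕ} (T : Term n) (x : Fin n) : ℕ :=
  if (x, true) ∈ T.1 then 1 else if (x, false) ∈ T.1 then 2 else 0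

/-- The input word of a list of terms: the number of variables, the number of terms, and
then, term after term, one symbol for each of the variables. -/
def encodeTerms {n : ℕ} (L : List (Term n)) : List ℕ :=
  n :: L.length :: L.flatMap fun T => List.ofFn (symbol T)

/-- The word `α(x_0) α(x_1) … α(x_{n-1})` of an assignment. -/
def encodeAssignment {n : ℕ} (α : Assignment n) : List ℕ :=
  List.ofFn fun x => (α x).toNat

end EnumDNF

end

namespace EnumDNF

/-! ### The machine -/

/-! The models of a monotone DNF form an up-set: they are exactly the assignments reached from the
least models of the terms (the rows of the input) by switching one variable at a time to true. The
machine searches this graph depth first.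

A model read as an `n`-digit binary number selects a cell of a table placed after the input, at
`address m α`. This cell does two jobs. It is nonzero exactly when the model has been visited, and
its value is the address of the entry below it on the stack. The bottom of the stack is the sentinel
`1`, so that even the lowest entry stores a nonzero link. Popping leaves the cell unchanged, so no
model is ever pushed twice. Only cells of models are ever written, and registers that hold `0` use
no bits, so the sparse table costs `O(n)` bits per model. The input has `n * m` one-bit cells, and
it is paid for by the models too, since distinct positive terms have distinct least models
(`le_ncard`, `space_le`).

For the delay, the rows are not pushed all at once: each round pops one model, outputs it, pushes
its `n` neighbours and reads at most one further row. The danger is that the stack runs empty while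
rows remain. It does not: after `t` rounds at least `t + 1` distinct rows have been visited, unless
all have been read, and only `t` models have been popped (`IsProgress.eq`). Once the stack is empty,
the popped models contain all rows and are closed under switching variables on, so they are all the
models. A round takes `O(n)` instructions on numbers of `O(n)` bits, hence time `O(n ^ 2)`.

The first output is special, because `n ^ 2` may exceed the preprocessing bound. The first row is
its own least model, so it is output directly from the input cells, before any encoding; when it is
later popped, a flag suppresses the second output. From then on its cells serve as the output
buffer.

Correctness, time and space are carried together by `Exec`, which follows symbolic register
contents. The invariants are `IsTable` for the memory, `IsProgress` for the search and `Paced` for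
the output times; `exists_reaches_halt` assembles them. -/

/-- The enumeration machine. Registers: `0` the number 1, `1` the start of the buffer,
`2` the end of the buffer, `3` the start of the table, `4` the next row, `5` the top of the stack,
`6` a power of two, `7` an address, `8` a counter, `9` scratch, `10` the current model,
`11` a position in the buffer, `12` a flag, `13` the number of variables,
`14` the number of rows left. -/
def machine : Program where
  base := 13
  code := [
    .jumpZero 14 64,
    .const 0 1,
    .const 1 15,
    .const 2 14,
    .add 2 2 13,
    .output 1 2,
    .mul 3 13 14,
    .add 3 3 1,
    .const 4 15,
    .const 5 1,
    -- 10: encode the next row and push it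
    .jumpZero 14 28,
    .sub 14 14 0,
    .const 6 1,
    .copy 7 3,
    .copy 8 13,
    .jumpZero 8 23,
    .load 9 4,
    .mul 9 9 6,
    .add 7 7 9,
    .add 6 6 6,
    .add 4 4 0,
    .sub 8 8 0,
    .jump 15,
    .load 9 7,
    .jumpZero 9 26,
    .jump 28,
    .store 7 5,
    .copy 5 7,
    -- 28: pop a model and decode it into the buffer
    .sub 9 5 0,
    .jumpZero 9 64,
    .copy 10 5,
    .load 5 5,
    .sub 7 10 3,
    .copy 11 2,
    .copy 8 13,
    .jumpZero 8 45,
    .add 7 7 7,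
    .sub 9 6 7,
    .sub 9 0 9,
    .store 11 9,
    .mul 9 9 6,
    .sub 7 7 9,
    .sub 11 11 0,
    .sub 8 8 0,
    .jump 35,
    -- 45: output the buffer, except for the first time
    .jumpZero 12 47,
    .output 1 2,
    -- 47: push the models with one more true variable
    .const 12 1,
    .const 6 1,
    .copy 8 13,
    .jumpZero 8 10,
    .add 11 11 0,
    .load 9 11,
    .sub 9 0 9,
    .mul 9 9 6,
    .add 7 10 9,
    .load 9 7,
    .jumpZero 9 59,
    .jump 61,
    .store 7 5,
    .copy 5 7,
    .add 6 6 6,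
    .sub 8 8 0,
    .jump 50]

/-! ### Symbolic execution -/

/-- The registers of the machine: `l` lists the contents of the first 15, `mem` the others. -/
def layout (l : List ℕ) (mem : ℕ → ℕ) (a : ℕ) : ℕ := if a < 15 then l.getD a 0 else mem a

/-- The bit lengths of all registers are bounded by `w`. -/
def Bounded (w : ℕ → ℕ) (c : Config) : Prop := ∀ a, Nat.size (c.regs a) ≤ w a

/-- The length is fixed so that `List.set` at an index below 15 really writes. -/
def Represents (l : List ℕ) (mem : ℕ → ℕ) (c : Config) : Prop :=
  l.length = 15 ∧ ⇑c.regs = layout l mem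

/-- `w` bounds the bit lengths in the first 15 registers by `W`, and in no register by more. -/
structure IsWeight (w : ℕ → ℕ) (W : ℕ) : Prop where
  reg : ∀ a < 15, w a = W
  le : ∀ a, w a ≤ W

/-- From `pc`, `l`, `mem`, the machine reaches `pc'`, `l'`, `mem'` in at most `k` steps, without
output and within the bounds `w` on the registers. -/
def Exec (w : ℕ → ℕ) (W pc : ℕ) (l : List ℕ) (mem : ℕ → ℕ)
    (k pc' : ℕ) (l' : List ℕ) (mem' : ℕ → ℕ) : Prop :=
  ∀ c : Config, c.pc = pc → Represents l mem c → Bounded w c →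
    ∃ k' ≤ k, (machine.step^[k'] c).pc = pc' ∧ Represents l' mem' (machine.step^[k'] c) ∧
      (machine.step^[k'] c).time ≤ c.time + k' * (1 + 2 * W) ∧
      (machine.step^[k'] c).outputs = c.outputs ∧
      ∀ j ≤ k', Bounded w (machine.step^[j] c)

section
variable {w : ℕ → ℕ} {W : ℕ}

theorem Exec.refl (pc : ℕ) (l : List ℕ) (mem : ℕ → ℕ) : Exec w W pc l mem 0 pc l mem := by
  intro c hpc hr hb
  refine ⟨0, le_rfl, hpc, hr, by simp, rfl, ?_⟩
  intro j hj
  obtain rfl : j = 0 := by omega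
  exact hb

theorem Exec.trans {pc pc' pc'' k₁ k₂ : ℕ} {l l' l'' : List ℕ} {mem mem' mem'' : ℕ → ℕ}
    (h₁ : Exec w W pc l mem k₁ pc' l' mem') (h₂ : Exec w W pc' l' mem' k₂ pc'' l'' mem'') :
    Exec w W pc l mem (k₁ + k₂) pc'' l'' mem'' := by
  intro c hpc hr hb
  obtain ⟨a, ha, hpc₁, hr₁, ht₁, ho₁, hb₁⟩ := h₁ c hpc hr hb
  obtain ⟨b, hb', hpc₂, hr₂, ht₂, ho₂, hb₂⟩ := h₂ _ hpc₁ hr₁ (hb₁ a le_rfl)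
  have e : ∀ j, machine.step^[j] (machine.step^[a] c) = machine.step^[j + a] c := fun j =>
    (Function.iterate_add_apply _ _ _ _).symm
  rw [e] at hpc₂ hr₂ ht₂ ho₂
  refine ⟨b + a, by omega, hpc₂, hr₂, ?_, ho₂.trans ho₁, ?_⟩
  · rw [add_mul]; omega
  · intro j hj
    by_cases h : j ≤ a
    · exact hb₁ j h
    · have := hb₂ (j - a) (by omega)
      rwa [e, Nat.sub_add_cancel (by omega)] at this

theorem Exec.mono {pc pc' k k' : ℕ} {l l' : List ℕ} {mem mem' : ℕ → ℕ}
    (h : Exec w W pc l mem k pc' l' mem') (hk : k ≤ k') : Exec w W pc l mem k' pc' l' mem' := by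
  intro c hpc hr hb
  obtain ⟨a, ha, h⟩ := h c hpc hr hb
  exact ⟨a, ha.trans hk, h⟩

/-- The effect of an instruction on a layout. -/
def Instr.effect (l : List ℕ) (mem : ℕ → ℕ) : Instr → List ℕ × (ℕ → ℕ)
  | .const r c => (l.set r c, mem)
  | .copy r s => (l.set r (l.getD s 0), mem)
  | .load r s => (l.set r (mem (l.getD s 0)), mem)
  | .store r s => (l, Function.update mem (l.getD r 0) (l.getD s 0))
  | .add r s t => (l.set r (l.getD s 0 + l.getD t 0), mem)
  | .sub r s t => (l.set r (l.getD s 0 - l.getD t 0), mem)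
  | .mul r s t => (l.set r (l.getD s 0 * l.getD t 0), mem)
  | _ => (l, mem)

/-- The instruction neither jumps nor outputs, `Instr.effect` describes it, and its result
satisfies the bounds. -/
def Instr.IsSafe (w : ℕ → ℕ) (W : ℕ) (l : List ℕ) : Instr → Prop
  | .const r c => r < 15 ∧ c < 2 ^ W
  | .copy r s => r < 15 ∧ s < 15
  | .load r s => r < 15 ∧ s < 15 ∧ 15 ≤ l.getD s 0
  | .store r s => r < 15 ∧ s < 15 ∧ 15 ≤ l.getD r 0 ∧ Nat.size (l.getD s 0) ≤ w (l.getD r 0)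
  | .add r s t => r < 15 ∧ s < 15 ∧ t < 15 ∧ l.getD s 0 + l.getD t 0 < 2 ^ W
  | .sub r s t => r < 15 ∧ s < 15 ∧ t < 15
  | .mul r s t => r < 15 ∧ s < 15 ∧ t < 15 ∧ l.getD s 0 * l.getD t 0 < 2 ^ W
  | _ => False

def effects : List Instr → List ℕ → (ℕ → ℕ) → List ℕ × (ℕ → ℕ)
  | [], l, mem => (l, mem)
  | I :: B, l, mem => effects B (I.effect l mem).1 (I.effect l mem).2

def AllSafe (w : ℕ → ℕ) (W : ℕ) : List Instr → List ℕ → (ℕ → ℕ) → Prop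
  | [], _, _ => True
  | I :: B, l, mem => I.IsSafe w W l ∧ AllSafe w W B (I.effect l mem).1 (I.effect l mem).2

theorem layout_lt {l : List ℕ} {mem : ℕ → ℕ} {a : ℕ} (ha : a < 15) :
    layout l mem a = l.getD a 0 := if_pos ha

theorem layout_ge {l : List ℕ} {mem : ℕ → ℕ} {a : ℕ} (ha : 15 ≤ a) :
    layout l mem a = mem a := if_neg (by omega)

theorem update_layout_lt {l : List ℕ} {mem : ℕ → ℕ} {r v : ℕ} (hl : l.length = 15)
    (hr : r < 15) : Function.update (layout l mem) r v = layout (l.set r v) mem := by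
  funext a
  by_cases h : a = r
  · subst h
    simp [layout, hr, List.getD_eq_getElem?_getD, hl]
  · rw [Function.update_of_ne h]
    simp [layout, List.getD_eq_getElem?_getD, List.getElem?_set_ne (Ne.symm h)]

theorem update_layout_ge {l : List ℕ} {mem : ℕ → ℕ} {r v : ℕ} (hr : 15 ≤ r) :
    Function.update (layout l mem) r v = layout l (Function.update mem r v) := by
  funext a
  by_cases h : a = r
  · subst h
    simp [layout, hr]
  · rw [Function.update_of_ne h]
    simp [layout, Function.update_of_ne h]

theorem Instr.coe_newRegs {I : Instr} {l : List ℕ} {mem : ℕ → ℕ} {R : ℕ →₀ ℕ}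
    (hI : I.IsSafe w W l) (hl : l.length = 15) (hR : ⇑R = layout l mem) :
    (I.effect l mem).1.length = 15 ∧
      ⇑(I.newRegs R) = layout (I.effect l mem).1 (I.effect l mem).2 := by
  cases I <;> simp only [IsSafe] at hI <;>
    simp only [newRegs, effect, Finsupp.coe_update, hR, List.length_set, hl, true_and]
  case const => rw [update_layout_lt hl hI.1]
  case copy => rw [update_layout_lt hl hI.1, layout_lt hI.2]
  case load => rw [update_layout_lt hl hI.1, layout_lt hI.2.1, layout_ge hI.2.2]
  case store =>
    rw [layout_lt hI.1, layout_lt hI.2.1, update_layout_ge hI.2.2.1]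
  case add => rw [update_layout_lt hl hI.1, layout_lt hI.2.1, layout_lt hI.2.2.1]
  case sub => rw [update_layout_lt hl hI.1, layout_lt hI.2.1, layout_lt hI.2.2]
  case mul => rw [update_layout_lt hl hI.1, layout_lt hI.2.1, layout_lt hI.2.2.1]

theorem size_update_le {R : ℕ →₀ ℕ} (hR : ∀ a, Nat.size (R a) ≤ w a) {r v : ℕ}
    (hv : Nat.size v ≤ w r) (a : ℕ) : Nat.size (R.update r v a) ≤ w a := by
  rw [Finsupp.coe_update]
  by_cases h : a = r
  · subst h; simpa using hv
  · rw [Function.update_of_ne h]; exact hR a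

theorem Instr.size_newRegs_le {I : Instr} {l : List ℕ} {mem : ℕ → ℕ} {R : ℕ →₀ ℕ}
    (hw : IsWeight w W) (hI : I.IsSafe w W l) (hR : ⇑R = layout l mem)
    (hb : ∀ a, Nat.size (R a) ≤ w a) (a : ℕ) : Nat.size (I.newRegs R a) ≤ w a := by
  have hW : ∀ a, Nat.size (R a) ≤ W := fun a => (hb a).trans (hw.le a)
  cases I <;> simp only [IsSafe] at hI <;> apply size_update_le hb
  case const => rw [hw.reg _ hI.1]; exact Nat.size_le.2 hI.2
  case copy => rw [hw.reg _ hI.1]; exact hW _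
  case load => rw [hw.reg _ hI.1]; exact hW _
  case store =>
    rw [hR, layout_lt hI.1, layout_lt hI.2.1]; exact hI.2.2.2
  case add =>
    rw [hw.reg _ hI.1, hR, layout_lt hI.2.1, layout_lt hI.2.2.1]; exact Nat.size_le.2 hI.2.2.2
  case sub =>
    rw [hw.reg _ hI.1]; exact (Nat.size_le_size (Nat.sub_le _ _)).trans (hW _)
  case mul =>
    rw [hw.reg _ hI.1, hR, layout_lt hI.2.1, layout_lt hI.2.2.1]; exact Nat.size_le.2 hI.2.2.2

theorem Instr.cost_le (hw : IsWeight w W) {R : ℕ →₀ ℕ} (hb : ∀ a, Nat.size (R a) ≤ w a)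
    (I : Instr) : I.cost R ≤ 1 + 2 * W := by
  have hW : ∀ a, Nat.size (R a) ≤ W := fun a => (hb a).trans (hw.le a)
  cases I <;> simp only [cost] <;> first | omega | skip
  all_goals
    rename_i s t
    have h₁ := hW s
    have h₂ := hW t
    omega

theorem Exec.of_step (hw : IsWeight w W) {pc pc' : ℕ} {l l' : List ℕ} {mem mem' : ℕ → ℕ}
    (I : Instr) (hI : machine.code[pc]? = some I)
    (h : ∀ R : ℕ →₀ ℕ, l.length = 15 → ⇑R = layout l mem → (∀ a, Nat.size (R a) ≤ w a) →
      I.newPc pc R = pc' ∧ l'.length = 15 ∧ ⇑(I.newRegs R) = layout l' mem' ∧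
      (∀ a, Nat.size (I.newRegs R a) ≤ w a) ∧ ∀ τ o, I.newOutputs τ R o = o) :
    Exec w W pc l mem 1 pc' l' mem' := by
  intro c hpc hr hb
  obtain ⟨h₁, h₂, h₃, h₄, h₅⟩ := h c.regs hr.1 hr.2 hb
  have hs : machine.step c = ⟨I.newPc c.pc c.regs, I.newRegs c.regs, c.time + I.cost c.regs,
      I.newOutputs (c.time + I.cost c.regs) c.regs c.outputs⟩ := by
    simp only [Program.step, hpc, hI]
  refine ⟨1, le_rfl, ?_⟩
  simp only [Function.iterate_one, hs]
  refine ⟨hpc ▸ h₁, ⟨h₂, h₃⟩, ?_, h₅ _ _, ?_⟩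
  · have := I.cost_le hw hb
    omega
  · intro j hj
    obtain rfl | rfl : j = 0 ∨ j = 1 := by omega
    · exact hb
    · intro a; simp only [Function.iterate_one, hs]; exact h₄ a

/-- Reduces straight-line code to computation: at each use `hB` holds by `rfl`, and what remains is
to evaluate `AllSafe` and `effects` on symbolic contents. -/
theorem Exec.block (hw : IsWeight w W) {pc pc' : ℕ} {l l' : List ℕ} {mem mem' : ℕ → ℕ}
    (B : List Instr) (hB : (machine.code.drop pc).take B.length = B)
    (hpc : pc + B.length = pc') (hs : AllSafe w W B l mem) (he : effects B l mem = (l', mem')) :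
    Exec w W pc l mem B.length pc' l' mem' := by
  induction B generalizing pc l mem with
  | nil =>
    simp only [effects, Prod.mk.injEq] at he
    obtain ⟨rfl, rfl⟩ := he
    simp only [List.length_nil, add_zero] at hpc ⊢
    subst hpc
    exact Exec.refl _ _ _
  | cons I B ih =>
    have hlt : pc < machine.code.length := by
      by_contra hc
      rw [List.drop_eq_nil_of_le (by omega)] at hB
      simp at hB
    rw [List.drop_eq_getElem_cons hlt, List.length_cons, List.take_succ_cons,
      List.cons.injEq] at hB
    have h₁ : Exec w W pc l mem 1 (pc + 1) (I.effect l mem).1 (I.effect l mem).2 := by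
      refine Exec.of_step hw I (by rw [List.getElem?_eq_getElem hlt, hB.1]) ?_
      intro R hl hR hb
      obtain ⟨h₁, h₂⟩ := Instr.coe_newRegs hs.1 hl hR
      refine ⟨?_, h₁, h₂, Instr.size_newRegs_le hw hs.1 hR hb, ?_⟩
      · have := hs.1
        cases I <;> simp_all [Instr.IsSafe, Instr.newPc]
      · have := hs.1
        cases I <;> simp_all [Instr.IsSafe, Instr.newOutputs]
    rw [List.length_cons] at hpc ⊢
    have h₂ := ih hB.2 (by omega) hs.2 he
    exact (h₁.trans h₂).mono (by omega)

theorem Exec.jump (hw : IsWeight w W) {pc l' : ℕ} {l : List ℕ} {mem : ℕ → ℕ}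
    (hI : machine.code[pc]? = some (.jump l')) : Exec w W pc l mem 1 l' l mem :=
  Exec.of_step hw _ hI fun _ hl hR hb => ⟨rfl, hl, hR, hb, fun _ _ => rfl⟩

theorem Exec.jumpZero (hw : IsWeight w W) {pc r l' : ℕ} {l : List ℕ} {mem : ℕ → ℕ}
    (hI : machine.code[pc]? = some (.jumpZero r l')) (hr : r < 15) (h : l.getD r 0 = 0) :
    Exec w W pc l mem 1 l' l mem :=
  Exec.of_step hw _ hI fun R hl hR hb =>
    ⟨by simp only [Instr.newPc, hR, layout_lt hr, h, if_true], hl, hR, hb, fun _ _ => rfl⟩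

theorem Exec.jumpZero_of_ne (hw : IsWeight w W) {pc r l' : ℕ} {l : List ℕ} {mem : ℕ → ℕ}
    (hI : machine.code[pc]? = some (.jumpZero r l')) (hr : r < 15) (h : l.getD r 0 ≠ 0) :
    Exec w W pc l mem 1 (pc + 1) l mem :=
  Exec.of_step hw _ hI fun R hl hR hb =>
    ⟨by simp only [Instr.newPc, hR, layout_lt hr, if_neg h], hl, hR, hb, fun _ _ => rfl⟩

end

end EnumDNF

namespace EnumDNF

/-! ### Models as addresses -/

/-- The number with the binary digits `f 0, …, f (i - 1)`, the least significant first. -/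
def binary (f : ℕ → ℕ) (i : ℕ) : ℕ := ∑ x ∈ Finset.range i, f x * 2 ^ x

theorem binary_succ (f : ℕ → ℕ) (i : ℕ) : binary f (i + 1) = binary f i + f i * 2 ^ i :=
  Finset.sum_range_succ _ _

theorem binary_lt {f : ℕ → ℕ} (hf : ∀ x, f x ≤ 1) (i : ℕ) : binary f i < 2 ^ i := by
  induction i with
  | zero => simp [binary]
  | succ i ih =>
    rw [binary_succ, pow_succ]
    have := Nat.mul_le_mul_right (2 ^ i) (hf i)
    omega

theorem binary_congr {f g : ℕ → ℕ} {i : ℕ} (h : ∀ x < i, f x = g x) : binary f i = binary g i :=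
  Finset.sum_congr rfl fun x hx => by rw [h x (Finset.mem_range.1 hx)]

theorem eq_of_binary_eq {f g : ℕ → ℕ} (hf : ∀ x, f x ≤ 1) (hg : ∀ x, g x ≤ 1) {i : ℕ}
    (h : binary f i = binary g i) : ∀ x < i, f x = g x := by
  induction i with
  | zero => intro x hx; omega
  | succ i ih =>
    rw [binary_succ, binary_succ] at h
    have h₁ := binary_lt hf i
    have h₂ := binary_lt hg i
    have key : f i = g i ∧ binary f i = binary g i := by
      rcases Nat.le_one_iff_eq_zero_or_eq_one.1 (hf i) with hf' | hf' <;>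
        rcases Nat.le_one_iff_eq_zero_or_eq_one.1 (hg i) with hg' | hg' <;>
        rw [hf', hg'] at h ⊢ <;> omega
    intro x hx
    rcases Nat.lt_succ_iff_lt_or_eq.1 hx with hx | rfl
    · exact ih key.2 x hx
    · exact key.1

/-- The factor `1 - f x` covers both values of the digit, so the machine finds the address of a
neighbour without branching. -/
theorem binary_update_one {f : ℕ → ℕ} (hf : ∀ x, f x ≤ 1) {x i : ℕ} (hx : x < i) :
    binary (Function.update f x 1) i = binary f i + (1 - f x) * 2 ^ x := by
  induction i with
  | zero => omega
  | succ i ih =>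
    rw [binary_succ, binary_succ]
    rcases Nat.lt_succ_iff_lt_or_eq.1 hx with hx | rfl
    · rw [ih hx, Function.update_of_ne (by omega)]; omega
    · rw [Function.update_self, binary_congr (g := f) fun y hy =>
        Function.update_of_ne (by omega) _ _]
      rcases Nat.le_one_iff_eq_zero_or_eq_one.1 (hf x) with h | h <;> rw [h] <;> omega

variable {n : ℕ}

/-- The value of the variable number `x` as a number. -/
def bit (α : Assignment n) (x : ℕ) : ℕ := if h : x < n then (α ⟨x, h⟩).toNat else 0

theorem bit_le (α : Assignment n) (x : ℕ) : bit α x ≤ 1 := by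
  unfold bit; split
  · exact Bool.toNat_le _
  · omega

def code (α : Assignment n) : ℕ := binary (bit α) n

theorem code_lt (α : Assignment n) : code α < 2 ^ n := binary_lt (bit_le α) n

theorem code_injective : Function.Injective (code (n := n)) := by
  intro α β h
  funext x
  have := eq_of_binary_eq (bit_le α) (bit_le β) h x x.2
  simp only [bit, x.2, dif_pos, Fin.eta] at this
  revert this
  cases α x <;> cases β x <;> simp

theorem bit_update_true (α : Assignment n) (x : Fin n) :
    bit (Function.update α x true) = Function.update (bit α) x 1 := by
  funext y
  by_cases h : y = x
  · subst h; simp [bit]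
  · rw [Function.update_of_ne h]
    unfold bit
    split
    · rw [Function.update_of_ne]
      rintro rfl
      exact h rfl
    · rfl

theorem code_update_true (α : Assignment n) (x : Fin n) :
    code (Function.update α x true) = code α + (1 - bit α x) * 2 ^ (x : ℕ) := by
  rw [code, bit_update_true, binary_update_one (bit_le α) x.2, code]

/-! ### The table of visited models -/

/-- The register of the table that belongs to `α`. -/
def address (m : ℕ) (α : Assignment n) : ℕ := 15 + n * m + code α

theorem address_injective (m : ℕ) : Function.Injective (address (n := n) m) := fun _ _ h =>
  code_injective (Nat.add_left_cancel h)

/-- `top` is the address of the first entry of the stack `S`, and each entry holds the address of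
the next one. -/
def IsStack (m : ℕ) (mem : ℕ → ℕ) : ℕ → List (Assignment n) → Prop
  | top, [] => top = 1
  | top, α :: S => top = address m α ∧ IsStack m mem (mem top) S

theorem IsStack.congr {m : ℕ} {mem mem' : ℕ → ℕ} {S : List (Assignment n)} {top : ℕ}
    (h : IsStack m mem top S) (he : ∀ α ∈ S, mem' (address m α) = mem (address m α)) :
    IsStack m mem' top S := by
  induction S generalizing top with
  | nil => exact h
  | cons α S ih =>
    obtain ⟨rfl, h⟩ := h
    refine ⟨rfl, ?_⟩
    rw [he α (by simp)]
    exact ih h fun β hβ => he β (by simp [hβ])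

/-- The contents of the memory when the rows before row `j` have been read, the models in `O` have
been popped and those in `S` are on the stack. -/
structure IsTable (m : ℕ) (row : ℕ → Assignment n) (A : Set (Assignment n)) (j : ℕ)
    (O S : List (Assignment n)) (mem : ℕ → ℕ) (top : ℕ) : Prop where
  rows : ∀ k, j ≤ k → k < m → ∀ x < n, mem (15 + n * k + x) = bit (row k) x
  visited : ∀ α, mem (address m α) ≠ 0 ↔ α ∈ O ++ S
  stack : IsStack m mem top S
  nodup : (O ++ S).Nodup
  subset : ∀ α ∈ O ++ S, α ∈ A

theorem row_lt_table {m k x : ℕ} (hk : k < m) (hx : x < n) : 15 + n * k + x < 15 + n * m := by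
  have := Nat.mul_le_mul_left n (Nat.succ_le_of_lt hk)
  rw [Nat.succ_eq_add_one, mul_add] at this
  omega

variable {m : ℕ} {row : ℕ → Assignment n} {A : Set (Assignment n)} {j : ℕ}
  {O S : List (Assignment n)} {mem : ℕ → ℕ} {top : ℕ}

theorem IsTable.top_ne_zero (h : IsTable m row A j O S mem top) : top ≠ 0 := by
  have := h.stack
  cases S with
  | nil => simp only [IsStack] at this; omega
  | cons α S => have := this.1; simp only [address] at this; omega

/-- Writing the old top into the cell of `β` both links it to the stack and marks it as visited,
because a top is never `0`. Other table cells are untouched since addresses are injective. -/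
theorem IsTable.push (h : IsTable m row A j O S mem top) {β : Assignment n} (hA : β ∈ A)
    (hβ : mem (address m β) = 0) :
    IsTable m row A j O (β :: S) (Function.update mem (address m β) top) (address m β) := by
  have hβ' : β ∉ O ++ S := fun hc => (h.visited β).2 hc hβ
  have hne : ∀ α ∈ O ++ S, Function.update mem (address m β) top (address m α)
      = mem (address m α) := fun α hα =>
    Function.update_of_ne (fun he => hβ' (by rwa [← address_injective m he])) _ _
  refine ⟨?_, ?_, ⟨rfl, ?_⟩, ?_, ?_⟩
  · intro k hk hkm x hx
    rw [Function.update_of_ne, h.rows k hk hkm x hx]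
    have := row_lt_table (n := n) hkm hx
    unfold address; omega
  · intro α
    by_cases hα : α = β
    · subst hα; simp [h.top_ne_zero]
    · rw [Function.update_of_ne (fun he => hα (address_injective m he)), h.visited]
      simp [hα]
  · rw [Function.update_self]
    exact h.stack.congr fun α hα => hne α (by simp [hα])
  · rw [(List.perm_middle).nodup_iff]
    exact List.nodup_cons.2 ⟨hβ', h.nodup⟩
  · intro α hα
    rw [List.perm_middle.mem_iff, List.mem_cons] at hα
    rcases hα with rfl | hα
    · exact hA
    · exact h.subset α hα

/-- The memory does not change: the popped cell keeps its nonzero link and so stays marked. -/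
theorem IsTable.pop {α : Assignment n} (h : IsTable m row A j O (α :: S) mem top) :
    IsTable m row A j (O ++ [α]) S mem (mem top) := by
  have e : O ++ [α] ++ S = O ++ α :: S := by simp
  exact ⟨h.rows, by rw [e]; exact h.visited, h.stack.2, by rw [e]; exact h.nodup,
    by rw [e]; exact h.subset⟩

theorem IsTable.succ (h : IsTable m row A j O S mem top) : IsTable m row A (j + 1) O S mem top :=
  ⟨fun k hk => h.rows k (by omega), h.visited, h.stack, h.nodup, h.subset⟩

/-- The memory with the first `n - i` cells of the buffer overwritten from the right
with digits of `f`. -/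
def overwrite (n : ℕ) (mem f : ℕ → ℕ) (i a : ℕ) : ℕ :=
  if 15 + i ≤ a ∧ a < 15 + n then f (a - 15) else mem a

theorem overwrite_self (mem f : ℕ → ℕ) : overwrite n mem f n = mem := by
  funext a; rw [overwrite, if_neg (by omega)]

theorem update_overwrite (mem f : ℕ → ℕ) {i : ℕ} (hi : i < n) :
    Function.update (overwrite n mem f (i + 1)) (15 + i) (f i) = overwrite n mem f i := by
  funext a
  by_cases h : a = 15 + i
  · subst h; simp [overwrite, hi]
  · rw [Function.update_of_ne h]
    unfold overwrite
    split <;> split <;> first | rfl | omega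

/-- The buffer occupies the cells of row `0`, which are no longer needed once `1 ≤ j`; the later
rows and the table lie above it. -/
theorem IsTable.overwrite (h : IsTable m row A j O S mem top) (hj : 1 ≤ j) (hm : 1 ≤ m)
    (f : ℕ → ℕ) (i : ℕ) : IsTable m row A j O S (overwrite n mem f i) top := by
  have hn : n ≤ n * m := Nat.le_mul_of_pos_right n hm
  have e : ∀ α : Assignment n, EnumDNF.overwrite n mem f i (address m α) = mem (address m α) := by
    intro α
    rw [EnumDNF.overwrite, if_neg]
    unfold address; omega
  refine ⟨?_, ?_, h.stack.congr fun α _ => e α, h.nodup, h.subset⟩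
  · intro k hk hkm x hx
    have : n ≤ n * k := Nat.le_mul_of_pos_right n (by omega)
    rw [EnumDNF.overwrite, if_neg (by omega), h.rows k hk hkm x hx]
  · intro α; rw [e]; exact h.visited α

end EnumDNF

namespace EnumDNF

/-! ### Subroutines of the machine and their step counts -/

/-- Bounds on the bit lengths that leave room for the models in `A` in the table. -/
structure IsBound (n m : ℕ) (A : Set (Assignment n)) (w : ℕ → ℕ) (W : ℕ) : Prop
    extends IsWeight w W where
  buffer : ∀ a, 15 ≤ a → a < 15 + n → 1 ≤ w a
  table : ∀ α ∈ A, w (address m α) = W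
  lt : 15 + n * m + 2 * 2 ^ n < 2 ^ W

/-- The first registers of the machine after its initialization. -/
def registers (n m row top h q i t p buf flag r : ℕ) : List ℕ :=
  [1, 15, 14 + n, 15 + n * m, row, top, h, q, i, t, p, buf, flag, n, r]

variable {n m : ℕ} {row : ℕ → Assignment n} {A : Set (Assignment n)} {j : ℕ}
  {O S : List (Assignment n)} {mem : ℕ → ℕ} {top : ℕ} {w : ℕ → ℕ} {W : ℕ}

theorem IsBound.one_le (hw : IsBound n m A w W) : 1 ≤ W := by
  by_contra h
  have h0 : W = 0 := by omega
  have := hw.lt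
  rw [h0] at this
  omega

theorem IsBound.two_pow_le (hw : IsBound n m A w W) {i : ℕ} (hi : i ≤ n) :
    15 + n * m + 2 * 2 ^ i < 2 ^ W := by
  have := Nat.pow_le_pow_right (n := 2) (by omega) hi
  have := hw.lt
  omega

theorem IsTable.size_top (hw : IsBound n m A w W) (h : IsTable m row A j O S mem top) :
    Nat.size top ≤ W := by
  rw [Nat.size_le]
  have h₀ := hw.lt
  have := h.stack
  cases S with
  | nil => simp only [IsStack] at this; omega
  | cons α S =>
    have := this.1
    have := code_lt α
    simp only [address] at *; omega

/-- The same push code occurs twice in the program, for rows and for neighbours. Cells below the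
table are preserved, which keeps the buffer intact while the neighbours are pushed. -/
theorem Exec.push (hw : IsBound n m A w W) {pc : ℕ} (hpc : pc = 23 ∨ pc = 56)
    (hT : IsTable m row A j O S mem top) {β : Assignment n} (hβ : β ∈ A)
    (ro h i t p buf flag r : ℕ) :
    ∃ t' S' mem' top', Exec w W pc (registers n m ro top h (address m β) i t p buf flag r) mem 4
        (pc + 5) (registers n m ro top' h (address m β) i t' p buf flag r) mem' ∧
      IsTable m row A j O S' mem' top' ∧ β ∈ O ++ S' ∧ S ⊆ S' ∧ S' ⊆ β :: S ∧
      ∀ a < 15 + n * m, mem' a = mem a := by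
  have hq : 15 ≤ address m β := by unfold address; omega
  have h₁ : Exec w W pc (registers n m ro top h (address m β) i t p buf flag r) mem 1
      (pc + 1) (registers n m ro top h (address m β) i (mem (address m β)) p buf flag r) mem := by
    refine Exec.block hw.toIsWeight [.load 9 7] ?_ rfl ?_ rfl
    · rcases hpc with rfl | rfl <;> rfl
    · simp [AllSafe, Instr.IsSafe, registers, hq]
  by_cases h0 : mem (address m β) = 0
  · refine ⟨_, β :: S, _, _, Exec.mono (h₁.trans ((Exec.jumpZero (l' := pc + 3) (r := 9)
      hw.toIsWeight ?_ (by omega) ?_).trans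
      (Exec.block (pc' := pc + 5) hw.toIsWeight [.store 7 5, .copy 5 7] ?_ rfl ?_ rfl))) ?_,
      hT.push hβ h0, ?_, ?_, ?_, ?_⟩
    · rcases hpc with rfl | rfl <;> rfl
    · exact h0
    · rcases hpc with rfl | rfl <;> rfl
    · simp [AllSafe, Instr.IsSafe, registers, hq, hw.table β hβ, hT.size_top hw]
    · simp
    · simp
    · simp
    · simp
    · intro a ha
      show Function.update mem (address m β) top a = mem a
      rw [Function.update_of_ne]
      unfold address; omega
  -- A nonzero cell means that `β` was visited before, so nothing is pushed.
  · refine ⟨_, S, _, _, Exec.mono (h₁.trans ((Exec.jumpZero_of_ne (l' := pc + 3) (r := 9)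
      hw.toIsWeight ?_ (by omega) ?_).trans
      (Exec.jump (l' := pc + 5) hw.toIsWeight ?_))) ?_, hT, ?_, ?_, ?_, ?_⟩
    · rcases hpc with rfl | rfl <;> rfl
    · exact h0
    · rcases hpc with rfl | rfl <;> rfl
    · omega
    · exact (hT.visited β).1 h0
    · simp
    · simp
    · simp

/-- Loop invariant: after `d` symbols the address register holds the start of the table plus the
first `d` digits, and register `6` holds `2 ^ d`. -/
theorem Exec.encode (hw : IsBound n m A w W) (hj : j < m)
    (hT : IsTable m row A j O S mem top) {i d : ℕ} (hd : d + i = n) (t p buf flag r : ℕ) :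
    ∃ t', Exec w W 15 (registers n m (15 + n * j + d) top (2 ^ d)
        (15 + n * m + binary (bit (row j)) d) i t p buf flag r) mem (8 * i + 1)
        23 (registers n m (15 + n * (j + 1)) top (2 ^ n) (address m (row j)) 0 t' p buf flag r)
        mem := by
  induction i generalizing d t with
  | zero =>
    obtain rfl : d = n := by omega
    rw [show 15 + d * (j + 1) = 15 + d * j + d by ring]
    exact ⟨t, Exec.jumpZero (r := 8) hw.toIsWeight rfl (by omega) rfl⟩
  | succ i ih =>
    obtain ⟨t', ih⟩ := ih (d := d + 1) (by omega) (bit (row j) d * 2 ^ d)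
    refine ⟨t', Exec.mono ((Exec.jumpZero_of_ne (r := 8) (l' := 23) hw.toIsWeight rfl
      (by omega) (by simp [registers])).trans ((Exec.block (pc' := 22) hw.toIsWeight
        [.load 9 4, .mul 9 9 6, .add 7 7 9, .add 6 6 6, .add 4 4 0, .sub 8 8 0] rfl rfl ?_ ?_).trans
        ((Exec.jump hw.toIsWeight rfl).trans ih))) (by simp only [List.length]; omega)⟩
    · have e := hT.rows j le_rfl hj d (by omega)
      have h₁ := hw.two_pow_le (i := d) (by omega)
      have h₂ := binary_lt (bit_le (row j)) d
      have h₃ := Nat.mul_le_mul_right (2 ^ d) (bit_le (row j) d)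
      have h₄ := row_lt_table (n := n) (x := d) hj (by omega)
      simp [AllSafe, Instr.IsSafe, Instr.effect, registers, e]
      omega
    · have e := hT.rows j le_rfl hj d (by omega)
      simp [effects, Instr.effect, registers, e, binary_succ, pow_succ]
      omega

theorem Exec.loadRow (hw : IsBound n m A w W) (hj : j < m) (hA : row j ∈ A)
    (hT : IsTable m row A j O S mem top) (h q i t p buf flag : ℕ) :
    ∃ t' S' mem' top', Exec w W 10 (registers n m (15 + n * j) top h q i t p buf flag (m - j)) mem
        (8 * n + 10) 28 (registers n m (15 + n * (j + 1)) top' (2 ^ n) (address m (row j)) 0 t' p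
          buf flag (m - (j + 1))) mem' ∧
      IsTable m row A (j + 1) O S' mem' top' ∧ row j ∈ O ++ S' ∧ S ⊆ S' ∧ S' ⊆ row j :: S := by
  obtain ⟨t₁, h₁⟩ := Exec.encode (i := n) (d := 0) hw hj hT (by omega) t p buf flag (m - (j + 1))
  obtain ⟨t', S', mem', top', h₂, h₃, h₄, h₅, h₆, -⟩ := Exec.push (pc := 23) hw (by omega) hT hA
    (15 + n * (j + 1)) (2 ^ n) 0 t₁ p buf flag (m - (j + 1))
  refine ⟨t', S', mem', top', Exec.mono ((Exec.jumpZero_of_ne (r := 14) (l' := 28)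
    hw.toIsWeight rfl (by omega) ?_).trans ((Exec.block (pc' := 15) hw.toIsWeight
    [.sub 14 14 0, .const 6 1, .copy 7 3, .copy 8 13] rfl rfl ?_ ?_).trans (h₁.trans h₂)))
    (by simp only [List.length]; omega), h₃.succ, h₄, h₅, h₆⟩
  · simp [registers]; omega
  · have := hw.one_le
    simp [AllSafe, Instr.IsSafe]
    omega
  · simp [effects, Instr.effect, registers, binary]
    omega

theorem Exec.loadRow_of_eq (hw : IsBound n m A w W) (l : List ℕ) (hl : l.getD 14 0 = 0) :
    Exec w W 10 l mem 1 28 l mem :=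
  Exec.jumpZero (r := 14) hw.toIsWeight rfl (by omega) hl

/-- Without division, digits are extracted from the most significant down: the number is doubled,
compared with `2 ^ n`, and reduced by `2 ^ n` if it is at least that large. The `i` digits still to
be found are kept shifted left by `n - i`. -/
theorem Exec.decode (hw : IsBound n m A w W) {α : Assignment n} (i ro t p flag r : ℕ)
    (hi : i ≤ n) : ∃ q' t', Exec w W 35 (registers n m ro top (2 ^ n)
        (binary (bit α) i * 2 ^ (n - i)) i t p (14 + i) flag r) (overwrite n mem (bit α) i)
        (10 * i + 1) 45 (registers n m ro top (2 ^ n) q' 0 t' p 14 flag r)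
        (overwrite n mem (bit α) 0) := by
  induction i generalizing t with
  | zero =>
    exact ⟨_, _, Exec.jumpZero (r := 8) hw.toIsWeight rfl (by omega) rfl⟩
  | succ i ih =>
    obtain ⟨q', t', ih⟩ := ih (bit α i * 2 ^ n) (by omega)
    have e₁ : 2 ^ (n - i) = 2 * 2 ^ (n - (i + 1)) := by
      rw [← pow_succ']; congr 1; omega
    have e₂ : 2 ^ i * 2 ^ (n - i) = 2 ^ n := by
      rw [← pow_add]; congr 1; omega
    have h₁ : binary (bit α) i * 2 ^ (n - i) < 2 ^ n := by
      rw [← e₂]; exact Nat.mul_lt_mul_of_pos_right (binary_lt (bit_le α) i) (by positivity)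
    have e₃ : binary (bit α) (i + 1) * 2 ^ (n - (i + 1)) + binary (bit α) (i + 1) *
        2 ^ (n - (i + 1)) = binary (bit α) i * 2 ^ (n - i) + bit α i * 2 ^ n := by
      rw [binary_succ, ← e₂, e₁]; ring
    -- Two truncated subtractions perform the comparison with `2 ^ n`; the lower digits contribute
    -- less than `2 ^ n` by `h₁`.
    have e₄ : 1 - (2 ^ n - (binary (bit α) i * 2 ^ (n - i) + bit α i * 2 ^ n)) = bit α i := by
      rcases Nat.le_one_iff_eq_zero_or_eq_one.1 (bit_le α i) with h | h <;> rw [h] <;> omega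
    refine ⟨q', t', Exec.mono ((Exec.jumpZero_of_ne (r := 8) (l' := 45) hw.toIsWeight rfl
      (by omega) (by simp [registers])).trans ((Exec.block (pc' := 44) hw.toIsWeight
        [.add 7 7 7, .sub 9 6 7, .sub 9 0 9, .store 11 9, .mul 9 9 6, .sub 7 7 9, .sub 11 11 0,
          .sub 8 8 0] rfl rfl ?_ ?_).trans
        ((Exec.jump hw.toIsWeight rfl).trans ih))) (by simp only [List.length]; omega)⟩
    · have h₂ := hw.lt
      have h₃ := Nat.mul_le_mul_right (2 ^ n) (bit_le α i)
      have h₄ := hw.buffer (14 + (i + 1)) (by omega) (by omega)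
      have h₅ : Nat.size (bit α i) ≤ 1 := by
        rw [Nat.size_le]; have := bit_le α i; omega
      simp [AllSafe, Instr.IsSafe, Instr.effect, registers, e₃, e₄]
      omega
    · have h := update_overwrite mem (bit α) (i := i) (n := n) (by omega)
      rw [show 15 + i = 14 + (i + 1) by omega] at h
      simp [effects, Instr.effect, registers, e₃, e₄, h]

theorem Exec.popModel (hw : IsBound n m A w W) {α : Assignment n}
    (hT : IsTable m row A j O (α :: S) mem top) (ro q i t p buf flag r : ℕ) :
    ∃ q' t', Exec w W 28 (registers n m ro top (2 ^ n) q i t p buf flag r) mem (10 * n + 8)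
      45 (registers n m ro (mem top) (2 ^ n) q' 0 t' (address m α) 14 flag r)
      (overwrite n mem (bit α) 0) := by
  have e : top = address m α := hT.stack.1
  obtain ⟨q', t', h⟩ := Exec.decode (mem := mem) (top := mem top) (α := α) hw n ro (top - 1)
    (address m α) flag r le_rfl
  rw [overwrite_self] at h
  -- The emptiness test is `top - 1`, which vanishes at the sentinel but not at an address.
  refine ⟨q', t', Exec.mono ((Exec.block (pc' := 29) hw.toIsWeight [.sub 9 5 0] rfl rfl ?_
    rfl).trans ((Exec.jumpZero_of_ne (r := 9) (l' := 64) hw.toIsWeight rfl (by omega) ?_).trans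
    ((Exec.block (pc' := 35) hw.toIsWeight
    [.copy 10 5, .load 5 5, .sub 7 10 3, .copy 11 2, .copy 8 13] rfl rfl ?_ ?_).trans h)))
    (by simp only [List.length]; omega)⟩
  · simp [AllSafe, Instr.IsSafe]
  · simp [Instr.effect, e, address, registers]; omega
  · simp [AllSafe, Instr.IsSafe, Instr.effect, e, address, registers]; omega
  · simp [effects, Instr.effect, registers, e]
    simp [address, code]

theorem Exec.popEmpty (hw : IsBound n m A w W)
    (hT : IsTable m row A j O [] mem top) (ro h q i t p buf flag r : ℕ) :
    ∃ l', Exec w W 28 (registers n m ro top h q i t p buf flag r) mem 2 64 l' mem := by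
  have e : top = 1 := hT.stack
  refine ⟨_, Exec.mono ((Exec.block (pc' := 29) hw.toIsWeight [.sub 9 5 0] rfl rfl ?_
    rfl).trans (Exec.jumpZero (r := 9) (l' := 64) hw.toIsWeight rfl (by omega) ?_))
    (by simp only [List.length]; omega)⟩
  · simp [AllSafe, Instr.IsSafe]
  · simp [Instr.effect, e, registers]

/-- A variable that is already true yields `α` itself as neighbour, and the push then finds it
visited. The doubling leaves `2 ^ n` in register `6`, as the next decoding requires even if no row
is read in between. -/
theorem Exec.expandLoop (hw : IsBound n m A w W) (hm : 1 ≤ m) {α : Assignment n}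
    (hA : ∀ x, Function.update α x true ∈ A)
    (hT : IsTable m row A j O S mem top) (hbuf : ∀ x < n, mem (15 + x) = bit α x)
    {i d : ℕ} (hd : d + i = n) (ro q t flag r : ℕ) :
    ∃ q' t' S' mem' top', Exec w W 50 (registers n m ro top (2 ^ d) q i t (address m α) (14 + d)
        flag r) mem (13 * i + 1) 10 (registers n m ro top' (2 ^ n) q' 0 t' (address m α) (14 + n)
        flag r) mem' ∧
      IsTable m row A j O S' mem' top' ∧
      (∀ x : Fin n, d ≤ x → Function.update α x true ∈ O ++ S') ∧ S ⊆ S' := by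
  induction i generalizing d q t S mem top with
  | zero =>
    obtain rfl : d = n := by omega
    refine ⟨_, _, _, _, _, Exec.jumpZero (r := 8) hw.toIsWeight rfl (by omega) rfl, hT, ?_, ?_⟩
    · intro x hx; have := x.2; omega
    · simp
  | succ i ih =>
    have hdn : d < n := by omega
    have hβ := hA ⟨d, hdn⟩
    have e : address m (Function.update α ⟨d, hdn⟩ true)
        = address m α + (1 - bit α d) * 2 ^ d := by
      rw [address, code_update_true, address]; simp only; omega
    have hn : n ≤ n * m := Nat.le_mul_of_pos_right n hm
    obtain ⟨t₁, S₁, mem₁, top₁, h₁, hT₁, hβ₁, hS₁, -, hm₁⟩ := Exec.push (pc := 56) hw (by omega) hT hβ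
      ro (2 ^ d) (i + 1) ((1 - bit α d) * 2 ^ d) (address m α) (14 + (d + 1)) flag r
    obtain ⟨q', t', S', mem', top', h₂, hT₂, hβ₂, hS₂⟩ := ih hT₁
      (fun x hx => by rw [hm₁ _ (by omega), hbuf x hx]) (d := d + 1) (by omega)
      (address m (Function.update α ⟨d, hdn⟩ true)) t₁
    refine ⟨q', t', S', mem', top', Exec.mono ((Exec.jumpZero_of_ne (r := 8) (l' := 10)
      hw.toIsWeight rfl (by omega) (by simp [registers])).trans ((Exec.block (pc' := 56)
      hw.toIsWeight [.add 11 11 0, .load 9 11, .sub 9 0 9, .mul 9 9 6, .add 7 10 9]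
      rfl rfl ?_ ?_).trans (h₁.trans ((Exec.block (pc' := 63)
      hw.toIsWeight [.add 6 6 6, .sub 8 8 0] rfl rfl ?_ ?_).trans
      ((Exec.jump hw.toIsWeight rfl).trans h₂))))) (by simp only [List.length]; omega), hT₂, ?_,
      fun _ h => hS₂ (hS₁ h)⟩
    · have h₃ := hw.two_pow_le (i := d) (by omega)
      have h₄ := hw.lt
      have h₅ := code_lt (Function.update α ⟨d, hdn⟩ true)
      have h₆ : (1 - bit α d) * 2 ^ d ≤ 2 ^ d := by simp
      have h₇ := hbuf d hdn
      rw [show 15 + d = 14 + d + 1 by omega] at h₇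
      have h₈ : address m α + (1 - bit α d) * 2 ^ d < 2 ^ W := by
        rw [← e, address]; omega
      simp [AllSafe, Instr.IsSafe, Instr.effect, registers, h₇]
      omega
    · have h₇ := hbuf d hdn
      rw [show 15 + d = 14 + (d + 1) by omega] at h₇
      simp [effects, Instr.effect, registers, h₇, e, add_assoc]
    · have h₃ := hw.two_pow_le (i := d) (by omega)
      simp [AllSafe, Instr.IsSafe, registers]
      omega
    · simp [effects, Instr.effect, registers, pow_succ]; omega
    · intro x hx
      rcases Nat.eq_or_lt_of_le hx with hx | hx
      · obtain rfl : x = ⟨d, hdn⟩ := Fin.ext hx.symm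
        rw [List.mem_append] at hβ₁ ⊢
        exact hβ₁.imp_right fun h => hS₂ h
      · exact hβ₂ x hx

theorem Exec.expand (hw : IsBound n m A w W) (hm : 1 ≤ m) {α : Assignment n}
    (hA : ∀ x, Function.update α x true ∈ A)
    (hT : IsTable m row A j O S mem top) (hbuf : ∀ x < n, mem (15 + x) = bit α x)
    (ro h q i t flag r : ℕ) :
    ∃ q' t' S' mem' top', Exec w W 47 (registers n m ro top h q i t (address m α) 14
        flag r) mem (13 * n + 4) 10 (registers n m ro top' (2 ^ n) q' 0 t' (address m α) (14 + n)
        1 r) mem' ∧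
      IsTable m row A j O S' mem' top' ∧
      (∀ x : Fin n, Function.update α x true ∈ O ++ S') ∧ S ⊆ S' := by
  obtain ⟨q', t', S', mem', top', h₁, hT', h₂, hS⟩ := Exec.expandLoop (i := n) (d := 0) hw hm hA
    hT hbuf (by omega) ro q t 1 r
  refine ⟨q', t', S', mem', top', Exec.mono ((Exec.block (pc' := 50)
      hw.toIsWeight [.const 12 1, .const 6 1, .copy 8 13] rfl rfl ?_ rfl).trans h₁)
      (by simp only [List.length]; omega), hT', fun x => h₂ x (Nat.zero_le _), hS⟩
  have := hw.one_le
  simp [AllSafe, Instr.IsSafe]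
  omega

end EnumDNF

namespace EnumDNF

/-! ### Time between outputs -/

theorem machine_step {c : Config} {I : Instr} (h : machine.code[c.pc]? = some I) :
    machine.step c = ⟨I.newPc c.pc c.regs, I.newRegs c.regs, c.time + I.cost c.regs,
      I.newOutputs (c.time + I.cost c.regs) c.regs c.outputs⟩ := by
  simp only [Program.step, h]

/-- The outputs are at most `D` apart, and the last output is at most `g` ago. -/
def Paced (D g : ℕ) (c : Config) : Prop :=
  (c.outputs.map Prod.fst).IsChain (fun τ τ' => τ' ≤ τ + D) ∧
    ∀ τ ∈ (c.outputs.map Prod.fst).getLast?, c.time ≤ τ + g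

theorem Paced.advance {D g g' : ℕ} {c c' : Config} (h : Paced D g c)
    (ho : c'.outputs = c.outputs) {s : ℕ} (ht : c'.time ≤ c.time + s) (hg : g + s ≤ g') :
    Paced D g' c' := by
  refine ⟨ho ▸ h.1, fun τ hτ => ?_⟩
  rw [ho] at hτ
  have := h.2 τ hτ
  omega

theorem Paced.isChain {D g : ℕ} {c : Config} (h : Paced D g c) (hg : g ≤ D) :
    c.eventTimes.IsChain (fun τ τ' => τ' ≤ τ + D) := by
  refine List.isChain_append.2 ⟨h.1, by simp, fun τ hτ τ' hτ' => ?_⟩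
  have := h.2 τ hτ
  simp only [List.head?_cons, Option.mem_def, Option.some.injEq] at hτ'
  omega

theorem Paced.output {D g : ℕ} {c c' : Config} (h : Paced D g c) {y : List ℕ}
    (ho : c'.outputs = c.outputs ++ [(c'.time, y)]) (ht : c'.time ≤ c.time + 1) (hg : g + 1 ≤ D) :
    Paced D 0 c' := by
  constructor
  · rw [ho, List.map_append]
    refine List.isChain_append.2 ⟨h.1, by simp, fun τ hτ τ' hτ' => ?_⟩
    have := h.2 τ hτ
    simp only [List.map_cons, List.map_nil, List.head?_cons, Option.mem_def,
      Option.some.injEq] at hτ'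
    omega
  · intro τ hτ
    rw [ho] at hτ
    simp at hτ
    omega

variable {n m : ℕ} {row : ℕ → Assignment n} {A : Set (Assignment n)} {j : ℕ}
  {O S : List (Assignment n)} {mem : ℕ → ℕ} {top : ℕ} {w : ℕ → ℕ} {W : ℕ}

theorem step_output {c : Config} {l : List ℕ} (hc : machine.code[c.pc]? = some (.output 1 2))
    (hr : Represents l mem c) (h₁ : l.getD 1 0 = 15) (h₂ : l.getD 2 0 = 14 + n)
    {α : Assignment n} (hα : ∀ x < n, mem (15 + x) = bit α x) :
    (machine.step c).pc = c.pc + 1 ∧ Represents l mem (machine.step c) ∧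
      (machine.step c).time = c.time + 1 ∧
      (machine.step c).outputs = c.outputs ++ [(c.time + 1, encodeAssignment α)] ∧
      (machine.step c).regs = c.regs := by
  rw [machine_step hc]
  refine ⟨rfl, hr, rfl, ?_, rfl⟩
  simp only [Instr.newOutputs, Instr.cost, hr.2]
  rw [layout_lt (by omega), layout_lt (by omega), h₁, h₂]
  congr 3
  apply List.ext_getElem
  · simp [encodeAssignment]
  · intro x hx hx'
    simp only [encodeAssignment, List.length_ofFn] at hx'
    have := hα x hx'
    simp only [bit, hx', dif_pos] at this
    simp [encodeAssignment, List.Ico, layout, this]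

/-! ### The main loop -/

/-- `A` is the set of models generated by the rows, which are distinct. -/
structure IsGenerated (m : ℕ) (row : ℕ → Assignment n) (A : Set (Assignment n)) : Prop where
  row_mem : ∀ k < m, row k ∈ A
  update_mem : ∀ α ∈ A, ∀ x, Function.update α x true ∈ A
  minimal : ∀ B : Set (Assignment n), (∀ k < m, row k ∈ B) →
    (∀ α ∈ B, ∀ x, Function.update α x true ∈ B) → A ⊆ B
  injOn : Set.InjOn row {k | k < m}

/-- What has been visited when the models in `O` have been popped, those in `S` are on the stack,
and `j` rows have been read. -/
structure IsProgress (m : ℕ) (row : ℕ → Assignment n) (j : ℕ) (O S : List (Assignment n)) :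
    Prop where
  pos : 1 ≤ j
  le : j ≤ m
  row_mem : ∀ k < j, row k ∈ O ++ S
  update_mem : ∀ α ∈ O, ∀ x, Function.update α x true ∈ O ++ S
  count : j = m ∨ O.length + 1 ≤ j

/-- With an empty stack, the `j` distinct rows read so far all lie in `O`, so `j ≤ O.length`; by
`count` this forces `j = m`. Then `O` contains every row and is closed under switching variables on,
and minimality of `A` applies. -/
theorem IsProgress.eq (hA : IsGenerated m row A) (hO : ∀ α ∈ O, α ∈ A)
    (h : IsProgress m row j O []) : ∀ α, α ∈ O ↔ α ∈ A := by
  classical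
  have hr := h.row_mem
  have hu := h.update_mem
  simp only [List.append_nil] at hr hu
  have hj : j = m := by
    rcases h.count with hj | hj
    · exact hj
    · exfalso
      have h₁ : ((Finset.range j).image row).card = j := by
        rw [Finset.card_image_of_injOn, Finset.card_range]
        intro a ha b hb hab
        have ha := Finset.mem_range.1 (Finset.mem_coe.1 ha)
        have hb := Finset.mem_range.1 (Finset.mem_coe.1 hb)
        have := h.le
        exact hA.injOn (show a < m by omega) (show b < m by omega) hab
      have h₂ : (Finset.range j).image row ⊆ O.toFinset := by
        intro α hα
        obtain ⟨k, hk, rfl⟩ := Finset.mem_image.1 hα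
        exact List.mem_toFinset.2 (hr k (Finset.mem_range.1 hk))
      have h₃ := Finset.card_le_card h₂
      have h₄ := List.toFinset_card_le O
      omega
  subst hj
  exact fun α => ⟨hO α, fun hα => hA.minimal {α | α ∈ O} hr hu hα⟩

/-- The part of a round after the output. Reading one row per popped model keeps `count` true,
whether or not that row had already been visited as a neighbour. -/
theorem Exec.expandLoad (hw : IsBound n m A w W) (hA : IsGenerated m row A) {α : Assignment n}
    (hT : IsTable m row A j (O ++ [α]) S mem top) (hP : IsProgress m row j O (α :: S))
    (hbuf : ∀ x < n, mem (15 + x) = bit α x) (h q i t flag : ℕ) :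
    ∃ q' i' t' p' buf' j' S' mem' top', Exec w W 47
        (registers n m (15 + n * j) top h q i t (address m α) 14 flag (m - j)) mem
        (21 * n + 14) 28 (registers n m (15 + n * j') top' (2 ^ n) q' i' t' p' buf' 1 (m - j'))
        mem' ∧
      IsTable m row A j' (O ++ [α]) S' mem' top' ∧ IsProgress m row j' (O ++ [α]) S' := by
  have hαA : α ∈ A := hT.subset α (by simp)
  have hm := hP.pos.trans hP.le
  obtain ⟨q₁, t₁, S₁, mem₁, top₁, h₁, hT₁, hα₁, hS₁⟩ := Exec.expand hw hm
    (hA.update_mem α hαA) hT hbuf (15 + n * j) h q i t flag (m - j)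
  have sub : ∀ S', S₁ ⊆ S' → O ++ (α :: S) ⊆ O ++ [α] ++ S' := by
    intro S' hS' β hβ
    simp only [List.mem_append, List.mem_cons, List.not_mem_nil, or_false] at hβ ⊢
    rcases hβ with hβ | hβ | hβ
    · exact .inl (.inl hβ)
    · exact .inl (.inr hβ)
    · exact .inr (hS' (hS₁ hβ))
  have upd : ∀ S', S₁ ⊆ S' → ∀ β ∈ O ++ [α], ∀ x, Function.update β x true ∈ O ++ [α] ++ S' := by
    intro S' hS' β hβ x
    rw [List.mem_append, List.mem_singleton] at hβ
    rcases hβ with hβ | rfl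
    · exact sub S' hS' (hP.update_mem β hβ x)
    · have := hα₁ x
      rw [List.mem_append] at this ⊢
      exact this.imp_right fun h => hS' h
  rcases Nat.eq_or_lt_of_le hP.le with hj | hj
  · refine ⟨_, _, _, _, _, j, S₁, mem₁, top₁, Exec.mono (h₁.trans (Exec.loadRow_of_eq hw _ ?_)) ?_,
      hT₁, hP.pos, hP.le, fun k hk => sub S₁ (fun _ h => h) (hP.row_mem k hk),
      upd S₁ (fun _ h => h), .inl hj⟩
    · simp [registers, hj]
    · omega
  · obtain ⟨t₂, S₂, mem₂, top₂, h₂, hT₂, hr₂, hS₂, -⟩ := Exec.loadRow hw hj (hA.row_mem j hj) hT₁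
      (2 ^ n) q₁ 0 t₁ (address m α) (14 + n) 1
    refine ⟨_, _, _, _, _, j + 1, S₂, mem₂, top₂, Exec.mono (h₁.trans h₂) ?_,
      hT₂, by omega, hj, ?_, upd S₂ hS₂, ?_⟩
    · omega
    · intro k hk
      rcases Nat.lt_succ_iff_lt_or_eq.1 hk with hk | rfl
      · exact sub S₂ hS₂ (hP.row_mem k hk)
      · exact hr₂
    · right
      rcases hP.count with h | h
      · omega
      · simp; omega

/-- The machine is about to pop a model. -/
structure IsPopState (m : ℕ) (row : ℕ → Assignment n) (A : Set (Assignment n)) (w : ℕ → ℕ)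
    (O : List (Assignment n)) (c : Config) : Prop where
  pc : c.pc = 28
  bounded : Bounded w c
  outputs : c.outputs.map Prod.snd = O.map encodeAssignment
  memory : ∃ q i t p buf j S mem top,
    Represents (registers n m (15 + n * j) top (2 ^ n) q i t p buf 1 (m - j)) mem c ∧
      IsTable m row A j O S mem top ∧ IsProgress m row j O S

/-- `c'` comes from `c` in `k` steps within the bounds `w`. -/
def Reaches (w : ℕ → ℕ) (k : ℕ) (c c' : Config) : Prop :=
  machine.step^[k] c = c' ∧ ∀ i ≤ k, Bounded w (machine.step^[i] c)

theorem Reaches.trans {k₁ k₂ : ℕ} {c c' c'' : Config} (h₁ : Reaches w k₁ c c')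
    (h₂ : Reaches w k₂ c' c'') : Reaches w (k₂ + k₁) c c'' := by
  refine ⟨by rw [Function.iterate_add_apply, h₁.1, h₂.1], fun i hi => ?_⟩
  by_cases h : i ≤ k₁
  · exact h₁.2 i h
  · have := h₂.2 (i - k₁) (by omega)
    rwa [← h₁.1, ← Function.iterate_add_apply, Nat.sub_add_cancel (by omega)] at this

theorem Exec.reaches {pc k pc' : ℕ} {l l' : List ℕ} {mem' : ℕ → ℕ}
    (h : Exec w W pc l mem k pc' l' mem') {c : Config} (hpc : c.pc = pc)
    (hr : Represents l mem c) (hb : Bounded w c) :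
    ∃ k' c', Reaches w k' c c' ∧ Bounded w c' ∧ c'.pc = pc' ∧ Represents l' mem' c' ∧
      c'.time ≤ c.time + k * (1 + 2 * W) ∧ c'.outputs = c.outputs := by
  obtain ⟨k', hk', h₁, h₂, h₃, h₄, h₅⟩ := h c hpc hr hb
  exact ⟨k', _, ⟨rfl, h₅⟩, h₅ k' le_rfl, h₁, h₂,
    h₃.trans (Nat.add_le_add_left (Nat.mul_le_mul_right _ hk') _), h₄⟩

theorem reaches_output {c : Config} {l : List ℕ} (hc : machine.code[c.pc]? = some (.output 1 2))
    (hr : Represents l mem c) (h₁ : l.getD 1 0 = 15) (h₂ : l.getD 2 0 = 14 + n)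
    {α : Assignment n} (hα : ∀ x < n, mem (15 + x) = bit α x) (hb : Bounded w c) :
    ∃ c', Reaches w 1 c c' ∧ Bounded w c' ∧ c'.pc = c.pc + 1 ∧ Represents l mem c' ∧
      c'.time ≤ c.time + 1 ∧ c'.outputs = c.outputs ++ [(c'.time, encodeAssignment α)] := by
  obtain ⟨h₁, h₂, h₃, h₄, h₅⟩ := step_output hc hr h₁ h₂ hα
  have hb' : Bounded w (machine.step c) := by
    intro a; rw [h₅]; exact hb a
  refine ⟨_, ⟨rfl, fun i hi => ?_⟩, hb', h₁, h₂, h₃.le, by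
    rw [Function.iterate_one, h₃]; exact h₄⟩
  obtain rfl | rfl : i = 0 ∨ i = 1 := by omega
  · exact hb
  · exact hb'

/-- Induction on the number of assignments not yet popped, which decreases because popped models are
distinct. The budget `g` covers the time from an output to the next pop; the further `10 * n + 10`
steps cover decoding, the flag test and the output. -/
theorem exists_reaches_halt (hw : IsBound n m A w W) (hA : IsGenerated m row A) {D g : ℕ}
    (hg : (21 * n + 14) * (1 + 2 * W) ≤ g) (hD : g + (10 * n + 10) * (1 + 2 * W) ≤ D)
    (c : Config) (hc : IsPopState m row A w O c) (hp : Paced D g c) :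
    ∃ k c', Reaches w k c c' ∧ c'.pc = 64 ∧ Paced D D c' ∧ c.outputs <+: c'.outputs ∧
      ∃ O' : List (Assignment n), c'.outputs.map Prod.snd = O'.map encodeAssignment ∧
        O'.Nodup ∧ ∀ α, α ∈ O' ↔ α ∈ A := by
  classical
  induction hN : Fintype.card (Assignment n) - O.length using Nat.strong_induction_on
    generalizing O c with
  | _ N ih =>
    obtain ⟨q, i, t, p, buf, j, S, mem, top, hr, hT, hP⟩ := hc.memory
    cases S with
    | nil =>
      obtain ⟨l', h⟩ := Exec.popEmpty hw hT (15 + n * j) (2 ^ n) q i t p buf 1 (m - j)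
      obtain ⟨k, c', hk, -, hpc, -, ht, ho⟩ := h.reaches hc.pc hr hc.bounded
      have hO := hT.subset
      have hnd := hT.nodup
      rw [List.append_nil] at hO hnd
      refine ⟨k, c', hk, hpc, hp.advance ho ht ?_, by rw [ho], O, by rw [ho, hc.outputs], hnd,
        hP.eq hA hO⟩
      refine le_trans (Nat.add_le_add_left (Nat.mul_le_mul_right _ ?_) _) hD
      omega
    | cons α S =>
      obtain ⟨q₁, t₁, h⟩ := Exec.popModel hw hT (15 + n * j) q i t p buf 1 (m - j)
      have h := h.trans (Exec.jumpZero_of_ne (r := 12) (l' := 47) hw.toIsWeight rfl (by omega)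
        (by simp [registers]))
      have hm := hP.pos.trans hP.le
      have hT₁ := hT.pop.overwrite hP.pos hm (bit α) 0
      have hbuf : ∀ x < n, overwrite n mem (bit α) 0 (15 + x) = bit α x := by
        intro x hx
        rw [overwrite, if_pos (by omega), Nat.add_sub_cancel_left]
      obtain ⟨k₁, c₁, hk₁, hb₁, hpc₁, hr₁, ht₁, ho₁⟩ := h.reaches hc.pc hr hc.bounded
      obtain ⟨c₂, hk₂, hb₂, hpc₂, hr₂, ht₂, ho₂⟩ := reaches_output (by rw [hpc₁]; rfl) hr₁
        (by rfl) (by rfl) hbuf hb₁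
      obtain ⟨q', i', t', p', buf', j', S', mem', top', h, hT₃, hP₃⟩ := Exec.expandLoad hw hA
        hT₁ hP hbuf (2 ^ n) q₁ 0 t₁ 1
      obtain ⟨k₃, c₃, hk₃, hb₃, hpc₃, hr₃, ht₃, ho₃⟩ := h.reaches (by rw [hpc₂, hpc₁]) hr₂ hb₂
      have hp₁ : Paced D (g + (10 * n + 9) * (1 + 2 * W)) c₁ := hp.advance ho₁ ht₁ le_rfl
      have hp₂ : Paced D 0 c₂ := hp₁.output ho₂ ht₂ (by
        refine le_trans ?_ hD
        rw [show (10 * n + 10) * (1 + 2 * W) = (10 * n + 9) * (1 + 2 * W) + (1 + 2 * W) by ring]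
        omega)
      have hp₃ : Paced D g c₃ := hp₂.advance ho₃ ht₃ (by omega)
      have hlen : (O ++ [α]).length ≤ Fintype.card (Assignment n) :=
        List.Nodup.length_le_card (hT₁.nodup.sublist (List.sublist_append_left _ _))
      have hl : (O ++ [α]).length = O.length + 1 := by simp
      obtain ⟨k, c', hk, hpc, hp', hpre, hO'⟩ := ih _ (by omega) c₃ (O := O ++ [α])
        ⟨hpc₃, hb₃, by rw [ho₃, ho₂, ho₁, List.map_append, hc.outputs]; simp,
          q', i', t', p', buf', j', S', mem', top', hr₃, hT₃, hP₃⟩ hp₃ rfl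
      refine ⟨_, c', ((hk₁.trans hk₂).trans hk₃).trans hk, hpc, hp', ?_, hO'⟩
      refine List.IsPrefix.trans ?_ hpre
      rw [ho₃, ho₂, ho₁]
      exact List.prefix_append _ _

end EnumDNF

namespace EnumDNF

variable {n m : ℕ} {row : ℕ → Assignment n} {A : Set (Assignment n)} {j : ℕ}
  {O S : List (Assignment n)} {mem : ℕ → ℕ} {top : ℕ} {w : ℕ → ℕ} {W : ℕ}

/-! ### Initialization -/

/-- The first output comes after six instructions. The following `39 * n + 37` steps finish the
setup, load row `0`, pop it with flag `0` so that it is not output again, and complete its round. -/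
theorem exists_reaches_popState (hw : IsBound n m A w W) (hA : IsGenerated m row A) (hm : 1 ≤ m)
    {c : Config} (hpc : c.pc = 0)
    (hr : Represents [0, 0, 0, 0, 0, 0, 0, 0, 0, 0, 0, 0, 0, n, m] mem c) (hb : Bounded w c)
    (ho : c.outputs = []) (ht : c.time = 0) (hT : IsTable m row A 0 [] [] mem 1) {D g : ℕ}
    (hg : (39 * n + 37) * (1 + 2 * W) ≤ g) :
    ∃ k c' O, Reaches w k c c' ∧ IsPopState m row A w O c' ∧ Paced D g c' ∧
      ∃ τ ∈ (c'.outputs.map Prod.fst).head?, τ ≤ 6 * (1 + 2 * W) := by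
  have hlt := hw.lt
  have hW := hw.one_le
  have hbuf : ∀ x < n, mem (15 + x) = bit (row 0) x := by
    intro x hx; simpa using hT.rows 0 le_rfl hm x hx
  have e₁ : Exec w W 0 [0, 0, 0, 0, 0, 0, 0, 0, 0, 0, 0, 0, 0, n, m] mem 5 5
      [1, 15, 14 + n, 0, 0, 0, 0, 0, 0, 0, 0, 0, 0, n, m] mem := by
    refine (Exec.jumpZero_of_ne (r := 14) (l' := 64) hw.toIsWeight rfl (by omega) ?_).trans
      (Exec.block (pc' := 5) hw.toIsWeight [.const 0 1, .const 1 15, .const 2 14, .add 2 2 13]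
      rfl rfl ?_ rfl)
    · simp; omega
    · have := Nat.le_mul_of_pos_right n hm
      simp [AllSafe, Instr.IsSafe, Instr.effect]
      omega
  have e₂ : Exec w W 6 [1, 15, 14 + n, 0, 0, 0, 0, 0, 0, 0, 0, 0, 0, n, m] mem 4 10
      (registers n m (15 + n * 0) 1 0 0 0 0 0 0 0 (m - 0)) mem := by
    refine Exec.block (pc' := 10) hw.toIsWeight [.mul 3 13 14, .add 3 3 1, .const 4 15, .const 5 1]
      rfl rfl ?_ ?_
    · simp [AllSafe, Instr.IsSafe, Instr.effect]
      omega
    · simp [effects, Instr.effect, registers, add_comm]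
  obtain ⟨k₁, c₁, hk₁, hb₁, hpc₁, hr₁, ht₁, ho₁⟩ := e₁.reaches hpc hr hb
  obtain ⟨c₂, hk₂, hb₂, hpc₂, hr₂, ht₂, ho₂⟩ := reaches_output (by rw [hpc₁]; rfl) hr₁
    (by rfl) (by rfl) hbuf hb₁
  obtain ⟨t₃, S, mem₃, top₃, e₃, hT₃, hrow, -, hS⟩ := Exec.loadRow hw hm (hA.row_mem 0 hm) hT
    0 0 0 0 0 0 0
  cases S with
  | nil => simp at hrow
  | cons α S =>
    obtain rfl : α = row 0 := by
      have := hS (List.mem_cons_self (a := α) (l := S))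
      simpa using this
    obtain ⟨q₄, t₄, e₄⟩ := Exec.popModel hw hT₃ (15 + n * (0 + 1)) (address m (row 0)) 0 t₃ 0 0 0
      (m - (0 + 1))
    have hT₄ := hT₃.pop.overwrite le_rfl hm (bit (row 0)) 0
    have e₅ := e₄.trans (Exec.jumpZero (r := 12) (l' := 47) hw.toIsWeight rfl (by omega)
      (by simp [registers]))
    obtain ⟨q', i', t', p', buf', j', S', mem', top', e₆, hT', hP'⟩ := Exec.expandLoad hw hA
      (O := []) hT₄ ⟨le_rfl, hm, fun k hk => by obtain rfl : k = 0 := by omega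
                                                simp, by simp, .inr (by simp)⟩
      (fun x hx => by rw [overwrite, if_pos (by omega), Nat.add_sub_cancel_left])
      (2 ^ n) q₄ 0 t₄ 0
    obtain ⟨k, c', hk, hb', hpc', hr', ht', ho'⟩ := (e₂.trans (e₃.trans (e₅.trans e₆))).reaches
      (by rw [hpc₂, hpc₁]) hr₂ hb₂
    rw [ho₁, ho, List.nil_append] at ho₂
    refine ⟨_, c', [row 0], (hk₁.trans hk₂).trans hk, ⟨hpc', hb', by rw [ho', ho₂]; rfl,
      q', i', t', p', buf', j', S', mem', top', hr', hT', hP'⟩, ⟨?_, ?_⟩, ?_⟩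
    · rw [ho', ho₂]; simp
    · intro τ hτ
      rw [ho', ho₂] at hτ
      simp only [List.map_cons, List.map_nil, List.getLast?_singleton, Option.mem_def,
        Option.some.injEq] at hτ
      subst hτ
      refine ht'.trans (Nat.add_le_add_left (le_trans (Nat.mul_le_mul_right _ ?_) hg) _)
      omega
    · refine ⟨c₂.time, by rw [ho', ho₂]; simp, ?_⟩
      omega

/-! ### Space -/

open Classical in
/-- Bit lengths sufficient for the machine. -/
noncomputable def weight (m : ℕ) (A : Set (Assignment n)) (W a : ℕ) : ℕ :=
  if a < 15 then W else if a < 15 + n * m then 1 else if ∃ α ∈ A, a = address m α then W else 0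

theorem isWeight_weight (m : ℕ) (A : Set (Assignment n)) (hW : 1 ≤ W) :
    IsWeight (weight m A W) W := by
  refine ⟨fun a ha => if_pos ha, fun a => ?_⟩
  unfold weight
  split_ifs <;> omega

theorem isBound_weight (hm : 1 ≤ m) (h : 15 + n * m + 2 * 2 ^ n < 2 ^ W) :
    IsBound n m A (weight m A W) W := by
  have hn := Nat.le_mul_of_pos_right n hm
  have hW : 1 ≤ W := by
    by_contra hc
    obtain rfl : W = 0 := by omega
    omega
  refine ⟨isWeight_weight m A hW, fun a h₁ h₂ => ?_, fun α hα => ?_, h⟩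
  · rw [weight, if_neg (by omega), if_pos (by omega)]
  · rw [weight, if_neg (by unfold address; omega), if_neg (by unfold address; omega),
      if_pos ⟨α, hα, rfl⟩]

/-- The weights are summed over working registers, input cells and table cells of models; everywhere
else weight `0` forces the register to be `0`. The `n * m` input bits are charged to the models by
`hm`. -/
theorem space_le (hm : m ≤ A.ncard) {c : Config} (hc : Bounded (weight m A W) c) :
    c.space ≤ 15 * W + n * A.ncard + A.ncard * W := by
  classical
  have hA := A.toFinite
  have hsub : c.regs.support ⊆ Finset.range 15 ∪ (Finset.Ico 15 (15 + n * m) ∪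
      hA.toFinset.image (address m)) := by
    intro a ha
    rw [Finsupp.mem_support_iff] at ha
    by_contra hn
    simp only [Finset.mem_union, Finset.mem_range, Finset.mem_Ico, Finset.mem_image,
      Set.Finite.mem_toFinset, not_or, not_lt, not_and] at hn
    have := hc a
    rw [weight, if_neg (by omega), if_neg (by omega), if_neg] at this
    · exact ha (Nat.size_eq_zero.1 (by omega))
    · rintro ⟨α, hα, rfl⟩
      exact hn.2.2 ⟨α, hα, rfl⟩
  have h₁ : ∑ a ∈ Finset.range 15, Nat.size (c.regs a) ≤ 15 * W := by
    refine (Finset.sum_le_card_nsmul _ _ W fun a ha => (hc a).trans ?_).trans (by simp)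
    rw [weight, if_pos (Finset.mem_range.1 ha)]
  have h₂ : ∑ a ∈ Finset.Ico 15 (15 + n * m), Nat.size (c.regs a) ≤ n * m := by
    refine (Finset.sum_le_card_nsmul _ _ 1 fun a ha => (hc a).trans ?_).trans (by simp)
    obtain ⟨ha, ha'⟩ := Finset.mem_Ico.1 ha
    rw [weight, if_neg (by omega), if_pos ha']
  have h₃ : ∑ a ∈ hA.toFinset.image (address m), Nat.size (c.regs a) ≤ A.ncard * W := by
    rw [Set.ncard_eq_toFinset_card A hA,
      ← Finset.card_image_of_injective _ (address_injective m), ← smul_eq_mul]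
    refine Finset.sum_le_card_nsmul _ _ W fun a ha => (hc a).trans ?_
    obtain ⟨α, hα, rfl⟩ := Finset.mem_image.1 ha
    rw [weight, if_neg (by unfold address; omega), if_neg (by unfold address; omega),
      if_pos ⟨α, hA.mem_toFinset.1 hα, rfl⟩]
  have h₄ := Nat.mul_le_mul_left n hm
  have union : ∀ s t : Finset ℕ, ∑ a ∈ s ∪ t, Nat.size (c.regs a) ≤
      ∑ a ∈ s, Nat.size (c.regs a) + ∑ a ∈ t, Nat.size (c.regs a) := fun s t => by
    rw [← Finset.sum_union_inter]; exact Nat.le_add_right _ _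
  calc c.space = ∑ a ∈ c.regs.support, Nat.size (c.regs a) := rfl
    _ ≤ _ := Finset.sum_le_sum_of_subset hsub
    _ ≤ _ := union _ _
    _ ≤ _ := Nat.add_le_add_left (union _ _) _
    _ ≤ _ := by omega

/-- The rows are distinct models. This also gives `m ≤ 2 ^ n`, which keeps addresses at `O(n)` bits.
-/
theorem le_ncard (hA : IsGenerated m row A) : m ≤ A.ncard := by
  classical
  have h : (row '' {k | k < m}).ncard = m := by
    rw [hA.injOn.ncard_image]
    have : {k | k < m} = ((Finset.range m : Finset ℕ) : Set ℕ) := by ext; simp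
    rw [this, Set.ncard_coe_finset, Finset.card_range]
  rw [← h]
  refine Set.ncard_le_ncard ?_ A.toFinite
  rintro _ ⟨k, hk, rfl⟩
  exact hA.row_mem k hk

theorem ncard_le_two_pow (A : Set (Assignment n)) : A.ncard ≤ 2 ^ n := by
  refine (Set.ncard_le_ncard (Set.subset_univ A) Set.finite_univ).trans ?_
  rw [Set.ncard_univ, Nat.card_eq_fintype_card]
  simp

theorem add_lt_two_pow (h : m ≤ 2 ^ n) : 15 + n * m + 2 * 2 ^ n < 2 ^ (2 * n + 6) := by
  have h₁ := Nat.mul_le_mul_left n h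
  have h₂ : n < 2 ^ n := Nat.lt_two_pow_self
  have h₃ := Nat.mul_le_mul_right (2 ^ n) h₂.le
  have h₄ : 2 ^ (2 * n + 6) = 64 * (2 ^ n * 2 ^ n) := by ring
  have h₅ := Nat.mul_le_mul_left (2 ^ n) (Nat.one_le_two_pow (n := n))
  have := Nat.one_le_two_pow (n := n)
  omega

/-! ### Formulas -/

/-- The least model of a term without negated literals. -/
def leastModel (T : Term n) : Assignment n := fun x => decide ((x, true) ∈ T.1)

def IsPositive (T : Term n) : Prop := ∀ l ∈ T.1, l.2 = true

theorem leastModel_injOn : Set.InjOn (leastModel (n := n)) {T | IsPositive T} := by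
  intro T hT T' hT' h
  apply Subtype.ext
  ext ⟨x, b⟩
  cases b with
  | true =>
    have := congrFun h x
    simpa [leastModel] using this
  | false =>
    exact ⟨fun h => absurd (hT _ h) (by simp), fun h => absurd (hT' _ h) (by simp)⟩

theorem satisfiesTerm_iff {T : Term n} (hT : IsPositive T) (α : Assignment n) :
    SatisfiesTerm α T ↔ ∀ x, leastModel T x = true → α x = true := by
  constructor
  · intro h x hx
    exact h (x, true) (by simpa [leastModel] using hx)
  · rintro h ⟨x, b⟩ hl
    obtain rfl : b = true := hT _ hl
    exact h x (by simpa [leastModel] using hl)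

theorem symbol_eq_bit {T : Term n} (hT : IsPositive T) (x : Fin n) :
    symbol T x = bit (leastModel T) x := by
  have h : (x, false) ∉ T.1 := fun h => absurd (hT _ h) (by simp)
  simp only [symbol, h, if_false, bit, x.2, dif_pos, leastModel, Fin.eta]
  split <;> rename_i h' <;> simp [h']

/-- The `k`-th row of the input as an assignment. -/
def inputRow (L : List (Term n)) (k : ℕ) : Assignment n :=
  if h : k < L.length then leastModel L[k] else fun _ => false

/-- The symbols of the rows of the input. -/
def inputSymbols (L : List (Term n)) : List ℕ := L.flatMap fun T => List.ofFn (symbol T)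

theorem length_inputSymbols (L : List (Term n)) : (inputSymbols L).length = n * L.length := by
  induction L with
  | nil => rfl
  | cons T L ih =>
    rw [inputSymbols, List.flatMap_cons, List.length_append, List.length_ofFn, List.length_cons]
    rw [inputSymbols] at ih
    rw [ih]; ring

theorem getD_inputSymbols {L : List (Term n)} (hL : ∀ T ∈ L, IsPositive T) {k x : ℕ}
    (hk : k < L.length) (hx : x < n) :
    (inputSymbols L).getD (n * k + x) 0 = bit (inputRow L k) x := by
  induction L generalizing k with
  | nil => simp at hk
  | cons T L ih =>
    have e : inputSymbols (T :: L) = List.ofFn (symbol T) ++ inputSymbols L := rfl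
    rw [e]
    cases k with
    | zero =>
      rw [List.getD_append _ _ _ _ (by simpa using hx)]
      have := symbol_eq_bit (hL T (by simp)) ⟨x, hx⟩
      simpa [List.getD_eq_getElem?_getD, hx, inputRow] using this
    | succ k =>
      have hk' : k < L.length := by simpa using hk
      rw [List.getD_append_right _ _ _ _ (by simp; nlinarith), List.length_ofFn,
        show n * (k + 1) + x - n = n * k + x by rw [mul_add]; omega,
        ih (fun T hT => hL T (by simp [hT])) hk']
      simp [inputRow, hk']

theorem getD_inputSymbols_le {L : List (Term n)} (hL : ∀ T ∈ L, IsPositive T) (a : ℕ) :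
    (inputSymbols L).getD a 0 ≤ 1 := by
  by_cases ha : a < (inputSymbols L).length
  · rw [List.getD_eq_getElem _ _ ha]
    have h := List.getElem_mem ha
    generalize (inputSymbols L)[a] = v at h
    obtain ⟨T, hT, hv⟩ := List.mem_flatMap.1 h
    obtain ⟨x, rfl⟩ := (List.mem_ofFn' _ _).1 hv
    rw [symbol_eq_bit (hL T hT)]
    exact bit_le _ _
  · rw [List.getD_eq_default _ _ (by omega)]
    omega

/-- A model lies above the least model of some term, and switching on its remaining true variables
one by one leads from that least model to it. -/
theorem isGenerated_sat {D : DNF n} (hD : IsMonotone D) {L : List (Term n)} (hL : L.Nodup)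
    (hLD : L.toFinset = D) : IsGenerated L.length (inputRow L) (sat D) := by
  have mem : ∀ T, T ∈ L ↔ T ∈ D := fun T => by rw [← hLD, List.mem_toFinset]
  have pos : ∀ T ∈ D, IsPositive T := hD
  have posL : ∀ (k : ℕ) (h : k < L.length), IsPositive L[k] := fun k h =>
    pos _ ((mem _).1 (List.getElem_mem h))
  have sat_iff : ∀ α, α ∈ sat D ↔ ∃ T ∈ D, ∀ x, leastModel T x = true → α x = true := fun α =>
    exists_congr fun T => and_congr_right fun hT => satisfiesTerm_iff (pos T hT) α
  refine ⟨?_, ?_, ?_, ?_⟩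
  · intro k hk
    rw [sat_iff, inputRow, dif_pos hk]
    exact ⟨_, (mem _).1 (List.getElem_mem hk), fun _ h => h⟩
  · intro α hα x
    rw [sat_iff] at hα ⊢
    obtain ⟨T, hT, h⟩ := hα
    refine ⟨T, hT, fun y hy => ?_⟩
    by_cases hxy : y = x
    · subst hxy; simp
    · rw [Function.update_of_ne hxy]; exact h y hy
  · intro B hB hu α hα
    obtain ⟨T, hT, h⟩ := (sat_iff α).1 hα
    -- The path from the least model to `α`: after `i` stages the true variables of `α` with index
    -- below `i` are on.
    have key : ∀ i ≤ n, (fun x : Fin n => leastModel T x || (decide ((x : ℕ) < i) && α x)) ∈ B := by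
      intro i
      induction i with
      | zero =>
        intro _
        obtain ⟨k, hk, rfl⟩ := List.getElem_of_mem ((mem T).2 hT)
        have := hB k hk
        rw [inputRow, dif_pos hk] at this
        simpa using this
      | succ i ih =>
        intro hi
        have ih := ih (by omega)
        by_cases hα : α ⟨i, hi⟩ = true
        · convert hu _ ih ⟨i, hi⟩ using 1
          funext x
          by_cases hx : x = ⟨i, hi⟩
          · subst hx; simp [hα]
          · rw [Function.update_of_ne hx]
            have : (x : ℕ) ≠ i := fun h => hx (Fin.ext h)
            simp only [Nat.lt_succ_iff_lt_or_eq, this, or_false]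
        · convert ih using 1
          funext x
          by_cases hx : x = ⟨i, hi⟩
          · subst hx; simp [hα]
          · have : (x : ℕ) ≠ i := fun h => hx (Fin.ext h)
            simp only [Nat.lt_succ_iff_lt_or_eq, this, or_false]
    convert key n le_rfl using 1
    funext x
    have := h x
    cases h₁ : leastModel T x <;> simp_all
  · intro a ha b hb hab
    simp only [Set.mem_ofPred_eq] at ha hb
    rw [inputRow, inputRow, dif_pos ha, dif_pos hb] at hab
    exact (hL.getElem_inj_iff).1 (leastModel_injOn (posL a ha) (posL b hb) hab)

theorem encodeAssignment_injective : Function.Injective (encodeAssignment (n := n)) := by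
  intro α β h
  funext x
  have := congrFun (List.ofFn_injective h) x
  revert this
  cases α x <;> cases β x <;> simp

/-! ### The initial configuration -/

theorem represents_init (L : List (Term n)) :
    Represents [0, 0, 0, 0, 0, 0, 0, 0, 0, 0, 0, 0, 0, n, L.length]
      (fun a => (inputSymbols L).getD (a - 15) 0) (machine.init (encodeTerms L)) := by
  refine ⟨rfl, ?_⟩
  have e : List.replicate machine.base 0 ++ encodeTerms L =
    [0, 0, 0, 0, 0, 0, 0, 0, 0, 0, 0, 0, 0, n, L.length] ++ inputSymbols L := rfl
  funext a
  rw [Program.init, e]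
  simp only [List.coe_toFinsupp, layout]
  split
  · rw [List.getD_append]; simpa using ‹a < 15›
  · rw [List.getD_append_right]
    · rfl
    · simp; omega

theorem bounded_init {L : List (Term n)} (hL : ∀ T ∈ L, IsPositive T) {A : Set (Assignment n)}
    (h : n < 2 ^ W) (h' : L.length < 2 ^ W) :
    Bounded (weight L.length A W) (machine.init (encodeTerms L)) := by
  intro a
  rw [(represents_init L).2, layout]
  unfold weight
  split
  · rename_i ha
    rw [Nat.size_le]
    have := Nat.one_le_two_pow (n := W)
    interval_cases a <;> simp [h, h']
  · split
    · rw [Nat.size_le]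
      have := getD_inputSymbols_le hL (a - 15)
      omega
    · rw [List.getD_eq_default _ _ (by rw [length_inputSymbols]; omega)]
      simp

theorem isTable_init {L : List (Term n)} (hL : ∀ T ∈ L, IsPositive T) :
    IsTable L.length (inputRow L) A 0 [] [] (fun a => (inputSymbols L).getD (a - 15) 0) 1 := by
  refine ⟨?_, ?_, rfl, List.nodup_nil, by simp⟩
  · intro k _ hk x hx
    rw [← getD_inputSymbols hL hk hx]
    congr 1; omega
  · intro α
    have : (inputSymbols L).getD (address L.length α - 15) 0 = 0 := by
      rw [List.getD_eq_default _ _ (by rw [length_inputSymbols]; unfold address; omega)]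
    simp only [this]
    simp

/-- The code has 64 instructions, so `c'` is a fixed point of the step and the bound persists for
ever. -/
theorem Reaches.bounded_run {k : ℕ} {c c' : Config} (h : Reaches w k c c') (hpc : c'.pc = 64)
    (i : ℕ) : Bounded w (machine.step^[i] c) := by
  by_cases hi : i ≤ k
  · exact h.2 i hi
  · have hfix : machine.step c' = c' := by
      have : machine.code[c'.pc]? = none := by rw [hpc]; rfl
      simp only [Program.step, this]
    have e : i = (i - k) + k := by omega
    rw [e, Function.iterate_add_apply, h.1, Function.iterate_fixed hfix, ← h.1]
    exact h.2 k le_rfl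

end EnumDNF

theorem mainTheorem3 :
    ∃ (P : EnumDNF.Program) (C : ℕ),
      ∀ (n : ℕ) (D : EnumDNF.DNF n), EnumDNF.IsMonotone D →
        ∀ L : List (EnumDNF.Term n), L.Nodup → L.toFinset = D →
          P.Enumerates (EnumDNF.encodeTerms L)
            (EnumDNF.encodeAssignment '' EnumDNF.sat D)
            (C * (n * D.card ^ 2 + 1))
            (C * (n ^ 2 + 1))
            (C * ((n + 1) * ((EnumDNF.sat D).ncard + 1))) := by
  open EnumDNF in
  refine ⟨machine, 2000, fun n D hD L hL hLD => ?_⟩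
  have hA := isGenerated_sat hD hL hLD
  have hcard : D.card = L.length := by rw [← hLD, List.toFinset_card_of_nodup hL]
  have hpos : ∀ T ∈ L, IsPositive T := fun T hT => hD T (by rw [← hLD]; simpa using hT)
  have hm := le_ncard hA
  have hlt := add_lt_two_pow (hm.trans (ncard_le_two_pow _))
  have hn : n < 2 ^ n := Nat.lt_two_pow_self
  have hlen : L.length ≤ 2 ^ n := hm.trans (ncard_le_two_pow _)
  -- By `hlt`, this many bits hold every address and intermediate value; a step then costs at most
  -- `1 + 2 * W = 4 * n + 13`.
  set W := 2 * n + 6 with hW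
  have hb : Bounded (weight L.length (sat D) W) (machine.init (encodeTerms L)) :=
    bounded_init hpos (by omega) (by omega)
  have hnn : n ≤ n ^ 2 := Nat.le_self_pow (by omega) n
  suffices h : ∃ k c', Reaches (weight L.length (sat D) W) k (machine.init (encodeTerms L)) c' ∧
      c'.pc = 64 ∧ (∀ τ ∈ c'.eventTimes.head?, τ ≤ 2000 * (n * D.card ^ 2 + 1)) ∧
      c'.eventTimes.IsChain (fun τ τ' => τ' ≤ τ + 2000 * (n ^ 2 + 1)) ∧
      ∃ O : List (Assignment n), c'.outputs.map Prod.snd = O.map encodeAssignment ∧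
        O.Nodup ∧ ∀ α, α ∈ O ↔ α ∈ sat D by
    obtain ⟨k, c', hk, hpc, hhead, hchain, O, hO, hnd, hmem⟩ := h
    constructor
    · refine ⟨k, ?_⟩
      rw [Program.run, hk.1]
      refine ⟨by rw [Program.Halted, hpc]; exact le_rfl, ?_, ?_, hhead, hchain⟩
      · rw [hO]; exact hnd.map encodeAssignment_injective
      · intro y
        rw [hO, List.mem_map]
        exact exists_congr fun α => and_congr_left fun _ => hmem α
    · intro i
      refine (space_le hm (hk.bounded_run hpc i)).trans ?_
      rw [hW]
      nlinarith [Nat.zero_le (n * (sat D).ncard)]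
  -- Without terms, the first instruction jumps straight to the halt.
  rcases Nat.eq_zero_or_pos L.length with h0 | h1
  · obtain rfl := List.eq_nil_of_length_eq_zero h0
    have hR : (machine.init (encodeTerms ([] : List (Term n)))).regs 14 = 0 := by
      rw [(represents_init ([] : List (Term n))).2]; rfl
    have hs := machine_step (c := machine.init (encodeTerms ([] : List (Term n))))
      (I := .jumpZero 14 64) rfl
    refine ⟨1, _, ⟨hs, fun i hi => ?_⟩, if_pos (e := 0 + 1) hR, ?_, List.isChain_singleton _, [], rfl,
      List.nodup_nil, fun α => ?_⟩
    · obtain rfl | rfl : i = 0 ∨ i = 1 := by omega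
      · exact hb
      · rw [Function.iterate_one, hs]; exact hb
    · intro τ hτ
      obtain rfl : 0 + 1 = τ := Option.some.inj hτ
      omega
    · have : sat D ⊆ ∅ := hA.minimal ∅ (by simp) (by simp)
      exact ⟨fun h => by simp at h, fun h => (this h).elim⟩
  · have hB := isBound_weight (A := sat D) h1 hlt
    obtain ⟨k₁, c₁, O, hk₁, hc₁, hp₁, τ, hτ, hτ'⟩ := exists_reaches_popState (D := 2000 * (n ^ 2 + 1)) hB hA
      h1 rfl (represents_init L) hb rfl rfl (isTable_init hpos) le_rfl
    -- Here `g = (39 * n + 37) * (1 + 2 * W)`, set by the first round, so the delay to verify is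
    -- `(49 * n + 47) * (4 * n + 13) ≤ 2000 * (n ^ 2 + 1)`.
    obtain ⟨k₂, c₂, hk₂, hpc₂, hp₂, ⟨out, hout⟩, hO⟩ := exists_reaches_halt hB hA
      (Nat.mul_le_mul_right _ (by omega)) (by rw [hW]; nlinarith) c₁ hc₁ hp₁
    refine ⟨_, c₂, hk₁.trans hk₂, hpc₂, ?_, hp₂.isChain le_rfl, hO⟩
    intro τ' h
    have : τ' = τ := by
      rw [Config.eventTimes, ← hout, List.map_append, List.append_assoc, List.head?_append,
        Option.mem_def.1 hτ] at h
      simpa using h.symm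
    subst this
    rw [hcard]
    have : n ≤ n * L.length ^ 2 := Nat.le_mul_of_pos_right n (by positivity)
    omega
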